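/- Let $d\in\{2,3\}$ and let $\Omega\subset\mathbb R^d$ be a non-empty bounded open set with Lipschitz boundary. Let $H^1_0(\Omega)$ be the closure of $C_c^\infty(\Omega)$ in $H^1(\Omega)$, $\boldsymbol X=\{\boldsymbol v\in H_0^1(\Omega)^d:\operatorname{div}\boldsymbol v=0\}$ (with the $H^1$-norm $\|\cdot\|_{1,\Omega}$), and let $\boldsymbol X^*$ and $[H^{-1}(\Omega)]^2$ be the duals of $\boldsymbol X$ and $[H^1_0(\Omega)]^2$, with dual norms $\|\cdot\|_{\boldsymbol X^*}$ and $\|\cdot\|_{-1,\Omega}$. For $0<\sigma<1$, $H^{1+\sigma}(\Omega)$ carries the norm $\|w\|_{1+\sigma,\Omega}^2=\|w\|_{1,\Omega}^2+\sum_i\iint_{\Omega\times\Omega}\frac{|\partial_iw(x)-\partial_iw(y)|^2}{|x-y|^{d+2\sigma}}\,dx\,dy$; norms of vector fields are the Euclidean combinations of those of the components. Data. $\boldsymbol K$ is a measurable, symmetric, uniformly positive definite $d\times d$ matrix field on $\Omega$ with $\boldsymbol v^\top\boldsymbol K^{-1}(x)\boldsymbol v\ge\alpha_1|\boldsymbol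 v|^2$ for some $\alpha_1>0$; $\nu\in C^2(\mathbb R)$ with $0<\nu_1\le\nu\le\nu_2$, $|\nu_T|\le C_{\nu_T}$ and bounded second derivative, where $\nu_T=\nu'$; $\boldsymbol F\in C^2(\mathbb R^2;\mathbb R^d)$ with $\|\boldsymbol F_{\boldsymbol y}\|\le C_{F_{\boldsymbol y}}$ and bounded second derivative, where $\boldsymbol F_{\boldsymbol y}$ is the derivative of $\boldsymbol F$; $\boldsymbol D$ is a constant real $2\times2$ matrix with $\boldsymbol s^\top\boldsymbol D\boldsymbol s\ge\alpha_2|\boldsymbol s|^2$ for some $\alpha_2>0$. For $\boldsymbol y=(T,S)$ put $$a(\boldsymbol y;\boldsymbol u,\boldsymbol v)=(\boldsymbol K^{-1}\boldsymbol u,\boldsymbol v)+(\nu(T)\nabla\boldsymbol u,\nabla\boldsymbol v),\quad c(\boldsymbol w,\boldsymbol u,\boldsymbol v)=((\boldsymbol w\cdot\nabla)\boldsymbol u,\boldsymbol v),$$ $$a_{\boldsymbol y}(\boldsymbol y,\boldsymbol s)=(\boldsymbol D\nabla\boldsymbol y,\nabla\boldsymbol s),\quad c_{\boldsymbol y}(\boldsymbol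 v,\boldsymbol y,\boldsymbol s)=((\boldsymbol v\cdot\nabla)\boldsymbol y,\boldsymbol s).$$ Constants. Let $0<\delta<\tfrac12$, $p_1=\frac{2d}{d-1-2\delta}$ (that is, $\frac4{1-2\delta}$ if $d=2$ and $\frac3{1-\delta}$ if $d=3$) and $\frac1{p_1}+\frac1{p_2}=\frac12$. Let $C_{p_d}$ be the best constant in $\|\boldsymbol w\|_{L^p(\Omega)}\le C\|\boldsymbol w\|_{1,\Omega}$ for $\boldsymbol w\in H^1(\Omega)^d$, $C_{gn}$ the best constant in $\|\nabla\boldsymbol w\|_{L^{p_1}(\Omega)}\le C\|\boldsymbol w\|_{3/2+\delta,\Omega}$ for $\boldsymbol w\in H^{3/2+\delta}(\Omega)^d$, $\alpha_a$ the largest constant with $a(\boldsymbol y;\boldsymbol v,\boldsymbol v)\ge\alpha_a\|\boldsymbol v\|_{1,\Omega}^2$ for all $\boldsymbol y\in H^1(\Omega)^2$, $\boldsymbol v\in H_0^1(\Omega)^d$, and $\hat\alpha_a$ the largest constant with $a_{\boldsymbol y}(\boldsymbol s,\boldsymbol s)\ge\hat\alpha_a\|\boldsymbol s\|^2_{1,\Omega}$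 for all $\boldsymbol s\in[H_0^1(\Omega)]^2$. Let $M_{\boldsymbol u},M_{\boldsymbol y},M>0$ satisfy $$\alpha_a>C_{6_d}C_{3_d}\left(\frac{C_{\nu_T}C_{p_{2_d}}C_{gn}MM_{\boldsymbol y}}{\hat\alpha_a}+M_{\boldsymbol u}+\frac{C_{F_{\boldsymbol y}}M_{\boldsymbol y}}{\hat\alpha_a}\right).$$ Theorem. There are constants $C_{\boldsymbol\psi},C_{\boldsymbol\chi}>0$ such that for all $\bar{\boldsymbol u}\in\boldsymbol X\cap H^{3/2+\delta}(\Omega)^d$ and $\bar{\boldsymbol y}=(\bar T,\bar S)\in[H^{3/2+\delta}(\Omega)]^2$ with $$\|\bar{\boldsymbol u}\|_{1,\Omega}\le M_{\boldsymbol u},\qquad\|\bar{\boldsymbol y}\|_{1,\Omega}\le M_{\boldsymbol y},\qquad\|\bar{\boldsymbol u}\|_{3/2+\delta,\Omega}+\|\bar{\boldsymbol y}\|_{3/2+\delta,\Omega}\le M$$ (in particular for states associated with an admissible control, with $M_{\boldsymbol u},M_{\boldsymbol y},M$ their a priori bounds), and for all $\hat{\boldsymbol f}\in\boldsymbol X^*$,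 $\tilde{\boldsymbol f}\in[H^{-1}(\Omega)]^2$, there is exactly one $(\boldsymbol\psi,\boldsymbol\chi)\in\boldsymbol X\times[H^1_0(\Omega)]^2$, $\boldsymbol\chi=(\chi^T,\chi^S)$, with $$a(\bar{\boldsymbol y};\boldsymbol\psi,\boldsymbol v)+c(\boldsymbol\psi,\bar{\boldsymbol u},\boldsymbol v)+c(\bar{\boldsymbol u},\boldsymbol\psi,\boldsymbol v)+(\nu_T(\bar T)\chi^T\nabla\bar{\boldsymbol u},\nabla\boldsymbol v)-(\boldsymbol F_{\boldsymbol y}(\bar{\boldsymbol y})\boldsymbol\chi,\boldsymbol v)=\langle\hat{\boldsymbol f},\boldsymbol v\rangle\quad\forall\boldsymbol v\in\boldsymbol X,$$ $$a_{\boldsymbol y}(\boldsymbol\chi,\boldsymbol s)+c_{\boldsymbol y}(\bar{\boldsymbol u},\boldsymbol\chi,\boldsymbol s)+c_{\boldsymbol y}(\boldsymbol\psi,\bar{\boldsymbol y},\boldsymbol s)=\langle\tilde{\boldsymbol f},\boldsymbol s\rangle\quad\forall\boldsymbol s\in[H^1_0(\Omega)]^2,$$ and it satisfies $$\|\boldsymbol\psi\|_{1,\Omega}\le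 C_{\boldsymbol\psi}\big(\|\hat{\boldsymbol f}\|_{\boldsymbol X^*}+\|\tilde{\boldsymbol f}\|_{-1,\Omega}\big),\qquad\|\boldsymbol\chi\|_{1,\Omega}\le C_{\boldsymbol\chi}\big(\|\hat{\boldsymbol f}\|_{\boldsymbol X^*}+\|\tilde{\boldsymbol f}\|_{-1,\Omega}\big).$$ -/

import Mathlib

open MeasureTheory Set Topology
open scoped ENNReal NNReal ContDiff

noncomputable section

namespace DoublyDiffusive

/-- Euclidean space `ℝ^d`. -/
abbrev Pt (d : ℕ) := EuclideanSpace ℝ (Fin d)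

/-- Locally near each boundary point, and up to a rigid motion, `Ω` is the strict subgraph of a
Lipschitz function. Here `e` is the vertical direction and `x - ⟪x, e⟫ e` the horizontal part. -/
def HasLipschitzBoundary {d : ℕ} (Ω : Set (Pt d)) : Prop :=
  ∀ x₀ ∈ frontier Ω, ∃ (e : Pt d) (g : Pt d → ℝ) (L : ℝ≥0), ∃ U ∈ 𝓝 x₀,
    ‖e‖ = 1 ∧ LipschitzWith L g ∧
      ∀ x ∈ U, (x ∈ Ω ↔ inner ℝ x e < g (x - (inner ℝ x e) • e))

/-! ### Sobolev spaces -/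

/-- `L²(Ω)`. -/
abbrev L2 {d : ℕ} (Ω : Set (Pt d)) := Lp ℝ 2 (volume.restrict Ω)

/-- Classical partial derivative. -/
def pderiv {d : ℕ} (i : Fin d) (φ : Pt d → ℝ) (x : Pt d) : ℝ :=
  fderiv ℝ φ x (EuclideanSpace.single i 1)

/-- `φ ∈ C_c^∞(Ω)`. -/
def IsTest {d : ℕ} (Ω : Set (Pt d)) (φ : Pt d → ℝ) : Prop :=
  ContDiff ℝ ∞ φ ∧ HasCompactSupport φ ∧ tsupport φ ⊆ Ω

/-- A function (component `none`) together with candidates for its first partial derivatives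
(component `some i`), all in `L²(Ω)`, with the Hilbert norm
`(‖u‖² + ∑ i, ‖∂ᵢ u‖²)^(1/2)`. -/
abbrev Jet {d : ℕ} (Ω : Set (Pt d)) := PiLp 2 (fun _ : Option (Fin d) => L2 Ω)

theorem IsTest.memLp {d : ℕ} {Ω : Set (Pt d)} {φ : Pt d → ℝ} (h : IsTest Ω φ) :
    MemLp φ 2 (volume.restrict Ω) :=
  (h.1.continuous.memLp_of_hasCompactSupport h.2.1).restrict Ω

theorem IsTest.memLp_pderiv {d : ℕ} {Ω : Set (Pt d)} {φ : Pt d → ℝ} (h : IsTest Ω φ)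
    (i : Fin d) : MemLp (pderiv i φ) 2 (volume.restrict Ω) := by
  have hc : Continuous (pderiv i φ) :=
    (h.1.continuous_fderiv (by simp)).clm_apply continuous_const
  have hs : HasCompactSupport (pderiv i φ) := h.2.1.fderiv_apply ℝ _
  exact (hc.memLp_of_hasCompactSupport hs).restrict Ω

/-- `H¹(Ω)`: the functions in `L²(Ω)` with weak first derivatives in `L²(Ω)`. -/
def H1 {d : ℕ} (Ω : Set (Pt d)) : Submodule ℝ (Jet Ω) where
  carrier := {w | ∀ φ, IsTest Ω φ → ∀ i : Fin d,
    ∫ x in Ω, w none x * pderiv i φ x = - ∫ x in Ω, w (some i) x * φ x}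
  zero_mem' := by
    intro φ _ i
    have h0 : ∀ k : Option (Fin d), ((0 : Jet Ω) k : Pt d → ℝ) =ᵐ[volume.restrict Ω] 0 :=
      fun k => Lp.coeFn_zero ℝ 2 _
    rw [integral_congr_ae (g := fun _ => (0 : ℝ)) (by
        filter_upwards [h0 none] with x hx; rw [hx]; simp),
      integral_congr_ae (f := fun x => (0 : Jet Ω) (some i) x * φ x) (g := fun _ => (0 : ℝ)) (by
        filter_upwards [h0 (some i)] with x hx; rw [hx]; simp)]
    simp
  add_mem' := by
    intro u v hu hv φ hφ i
    have ha : ∀ k : Option (Fin d), ((u + v) k : Pt d → ℝ) =ᵐ[volume.restrict Ω]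
        fun x => u k x + v k x := fun k => Lp.coeFn_add (u k) (v k)
    have e1 : ∫ x in Ω, (u + v) none x * pderiv i φ x =
        (∫ x in Ω, u none x * pderiv i φ x) + ∫ x in Ω, v none x * pderiv i φ x := by
      refine Eq.trans ?_ (integral_add ((Lp.memLp (u none)).integrable_mul (hφ.memLp_pderiv i))
        ((Lp.memLp (v none)).integrable_mul (hφ.memLp_pderiv i)))
      refine integral_congr_ae ?_
      filter_upwards [ha none] with x hx
      rw [hx]; ring
    have e2 : ∫ x in Ω, (u + v) (some i) x * φ x =
        (∫ x in Ω, u (some i) x * φ x) + ∫ x in Ω, v (some i) x * φ x := by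
      refine Eq.trans ?_ (integral_add ((Lp.memLp (u (some i))).integrable_mul hφ.memLp)
        ((Lp.memLp (v (some i))).integrable_mul hφ.memLp))
      refine integral_congr_ae ?_
      filter_upwards [ha (some i)] with x hx
      rw [hx]; ring
    rw [e1, e2, hu φ hφ i, hv φ hφ i]; ring
  smul_mem' := by
    intro c u hu φ hφ i
    have ha : ∀ k : Option (Fin d), ((c • u) k : Pt d → ℝ) =ᵐ[volume.restrict Ω]
        fun x => c * u k x := fun k => Lp.coeFn_smul c (u k)
    have e1 : ∫ x in Ω, (c • u) none x * pderiv i φ x =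
        c * ∫ x in Ω, u none x * pderiv i φ x := by
      rw [← integral_const_mul]
      refine integral_congr_ae ?_
      filter_upwards [ha none] with x hx
      rw [hx]; ring
    have e2 : ∫ x in Ω, (c • u) (some i) x * φ x = c * ∫ x in Ω, u (some i) x * φ x := by
      rw [← integral_const_mul]
      refine integral_congr_ae ?_
      filter_upwards [ha (some i)] with x hx
      rw [hx]; ring
    rw [e1, e2, hu φ hφ i]; ring

/-- `H¹₀(Ω)`: the closure of `C_c^∞(Ω)` in `H¹(Ω)` (on a bounded Lipschitz domain, the functions
in `H¹(Ω)` with zero trace). -/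
def H10 {d : ℕ} (Ω : Set (Pt d)) : Submodule ℝ (H1 Ω) :=
  (Submodule.span ℝ {w : H1 Ω | ∃ φ, IsTest Ω φ ∧
    ((w : Jet Ω) none : Pt d → ℝ) =ᵐ[volume.restrict Ω] φ}).topologicalClosure

/-- `H¹(Ω)^m` with its Hilbert norm `‖·‖_{1,Ω}`. -/
abbrev H1v {d : ℕ} (Ω : Set (Pt d)) (m : ℕ) := PiLp 2 (fun _ : Fin m => H1 Ω)

/-- The value at `x` of a vector field in `H¹(Ω)^m`. -/
def val {d m : ℕ} {Ω : Set (Pt d)} (w : H1v Ω m) (x : Pt d) : EuclideanSpace ℝ (Fin m) :=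
  WithLp.toLp 2 (fun j => (w j : Jet Ω) none x)

/-- `∂ᵢ wⱼ (x)`. -/
def grad {d m : ℕ} {Ω : Set (Pt d)} (w : H1v Ω m) (j : Fin m) (i : Fin d) (x : Pt d) : ℝ :=
  (w j : Jet Ω) (some i) x

/-- `H¹₀(Ω)^m`. -/
def H10v {d : ℕ} (Ω : Set (Pt d)) (m : ℕ) : Submodule ℝ (H1v Ω m) where
  carrier := {w | ∀ j, w j ∈ H10 Ω}
  zero_mem' := fun _ => (H10 Ω).zero_mem
  add_mem' := fun hu hv j => (H10 Ω).add_mem (hu j) (hv j)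
  smul_mem' := fun c _ hu j => (H10 Ω).smul_mem c (hu j)

/-- The divergence `∑ i, ∂ᵢ vᵢ` in `L²(Ω)`. -/
def divergence {d : ℕ} {Ω : Set (Pt d)} (v : H1v Ω d) : L2 Ω := ∑ i, (v i : Jet Ω) (some i)

/-- `X`: the divergence-free fields in `H¹₀(Ω)^d`. -/
def X {d : ℕ} (Ω : Set (Pt d)) : Submodule ℝ (H1v Ω d) where
  carrier := {v | v ∈ H10v Ω d ∧ divergence v = 0}
  zero_mem' := ⟨(H10v Ω d).zero_mem, by simp [divergence]⟩
  add_mem' := by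
    rintro u v ⟨hu, hu'⟩ ⟨hv, hv'⟩
    refine ⟨(H10v Ω d).add_mem hu hv, ?_⟩
    have : divergence (u + v) = divergence u + divergence v := by
      simp [divergence, Finset.sum_add_distrib]
    rw [this, hu', hv', add_zero]
  smul_mem' := by
    rintro c u ⟨hu, hu'⟩
    refine ⟨(H10v Ω d).smul_mem c hu, ?_⟩
    have : divergence (c • u) = c • divergence u := by
      simp [divergence, Finset.smul_sum]
    rw [this, hu', smul_zero]

/-- Square of the Gagliardo–Slobodeckij seminorm of order `σ ∈ (0,1)` on `Ω ⊆ ℝ^d`. -/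
def gagliardoSq {d : ℕ} (Ω : Set (Pt d)) (σ : ℝ) (f : Pt d → ℝ) : ℝ≥0∞ :=
  ∫⁻ x in Ω, ∫⁻ y in Ω, ‖f x - f y‖ₑ ^ 2 / ‖x - y‖ₑ ^ ((d : ℝ) + 2 * σ)

/-- The norm `‖w‖_{1+σ,Ω}` of a field in `H¹(Ω)^m`, for `σ ∈ (0,1)`; the value is `∞` when `w` is
not in `H^{1+σ}(Ω)^m`. -/
def fracNorm {d m : ℕ} {Ω : Set (Pt d)} (σ : ℝ) (w : H1v Ω m) : ℝ≥0∞ :=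
  (‖w‖ₑ ^ 2 + ∑ j, ∑ i, gagliardoSq Ω σ (grad w j i)) ^ (1 / 2 : ℝ)

/-- `w ∈ H^{1+σ}(Ω)^m`. -/
def MemFrac {d m : ℕ} {Ω : Set (Pt d)} (σ : ℝ) (w : H1v Ω m) : Prop := fracNorm σ w < ⊤

/-- The norm of `w` in `L^p(Ω)^m`. -/
def lpNorm {d m : ℕ} {Ω : Set (Pt d)} (p : ℝ≥0∞) (w : H1v Ω m) : ℝ≥0∞ :=
  eLpNorm (val w) p (volume.restrict Ω)

/-- The `L^p(Ω)` norm of `∇w` (pointwise Frobenius norm). -/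
def gradLpNorm {d m : ℕ} {Ω : Set (Pt d)} (p : ℝ≥0∞) (w : H1v Ω m) : ℝ≥0∞ :=
  eLpNorm (fun x => √(∑ j, ∑ i, grad w j i x ^ 2)) p (volume.restrict Ω)

/-! ### The forms of the problem -/

/-- `a(y; u, v) = (K⁻¹ u, v) + (ν(T) ∇u, ∇v)`, where `T` is the first component of `y`. -/
def formA {d : ℕ} {Ω : Set (Pt d)} (K : Pt d → Matrix (Fin d) (Fin d) ℝ) (ν : ℝ → ℝ)
    (y : H1v Ω 2) (u v : H1v Ω d) : ℝ :=
  (∫ x in Ω, ∑ i, ∑ j, (K x)⁻¹ i j * val u x j * val v x i) +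
    ∫ x in Ω, ν (val y x 0) * ∑ j, ∑ i, grad u j i x * grad v j i x

/-- `((w · ∇) u, v)`; this is `c` for `m = d` and `c_y` for `m = 2`. -/
def formC {d m : ℕ} {Ω : Set (Pt d)} (w : H1v Ω d) (u v : H1v Ω m) : ℝ :=
  ∫ x in Ω, ∑ j, (∑ i, val w x i * grad u j i x) * val v x j

/-- `a_y(y, s) = (D ∇y, ∇s)`. -/
def formAy {d : ℕ} {Ω : Set (Pt d)} (D : Matrix (Fin 2) (Fin 2) ℝ) (y s : H1v Ω 2) : ℝ :=
  ∫ x in Ω, ∑ i, ∑ k, ∑ l, D k l * grad y l i x * grad s k i x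

/-- `(ν_T(T̄) χ^T ∇ū, ∇v)`. -/
def formNuT {d : ℕ} {Ω : Set (Pt d)} (ν : ℝ → ℝ) (ybar χ : H1v Ω 2) (ubar v : H1v Ω d) : ℝ :=
  ∫ x in Ω, deriv ν (val ybar x 0) * val χ x 0 * ∑ j, ∑ i, grad ubar j i x * grad v j i x

/-- `(F_y(ȳ) χ, v)`. -/
def formFy {d : ℕ} {Ω : Set (Pt d)} (F : Pt 2 → Pt d) (ybar χ : H1v Ω 2) (v : H1v Ω d) : ℝ :=
  ∫ x in Ω, inner ℝ (fderiv ℝ F (val ybar x) (val χ x)) (val v x)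

/-- `(ψ, χ)` solves the equations linearized at `(ū, ȳ)` with right-hand sides `f̂`, `f̃`. -/
def IsLinearizedSolution {d : ℕ} {Ω : Set (Pt d)} (K : Pt d → Matrix (Fin d) (Fin d) ℝ)
    (ν : ℝ → ℝ) (F : Pt 2 → Pt d) (D : Matrix (Fin 2) (Fin 2) ℝ) (ubar : H1v Ω d)
    (ybar : H1v Ω 2) (fhat : StrongDual ℝ (X Ω)) (ftil : StrongDual ℝ (H10v Ω 2))
    (ψ : X Ω) (χ : H10v Ω 2) : Prop :=
  (∀ v : X Ω,
    formA K ν ybar ψ v + formC (ψ : H1v Ω d) ubar (v : H1v Ω d)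
      + formC ubar (ψ : H1v Ω d) (v : H1v Ω d)
      + formNuT ν ybar χ ubar v - formFy F ybar χ v = fhat v) ∧
  (∀ s : H10v Ω 2,
    formAy D (χ : H1v Ω 2) s + formC ubar (χ : H1v Ω 2) (s : H1v Ω 2)
      + formC (ψ : H1v Ω d) ybar (s : H1v Ω 2) = ftil s)

/-! ### The constants in the smallness condition -/

/-- The best constant `C` in `‖w‖_{L^p(Ω)} ≤ C ‖w‖_{1,Ω}`, `w ∈ H¹(Ω)^d`. -/
def embConst {d : ℕ} (Ω : Set (Pt d)) (p : ℝ≥0∞) : ℝ≥0∞ :=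
  sInf {C | ∀ w : H1v Ω d, lpNorm p w ≤ C * ‖w‖ₑ}

/-- The best constant `C` in `‖∇w‖_{L^p(Ω)} ≤ C ‖w‖_{1+σ,Ω}`, `w ∈ H^{1+σ}(Ω)^d`. -/
def gradEmbConst {d : ℕ} (Ω : Set (Pt d)) (σ : ℝ) (p : ℝ≥0∞) : ℝ≥0∞ :=
  sInf {C | ∀ w : H1v Ω d, MemFrac σ w → gradLpNorm p w ≤ C * fracNorm σ w}

/-- The best constant `α_a` in `a(y; v, v) ≥ α_a ‖v‖²_{1,Ω}`, for `y ∈ H¹(Ω)²` and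
`v ∈ H¹₀(Ω)^d`. -/
def coercA {d : ℕ} (Ω : Set (Pt d)) (K : Pt d → Matrix (Fin d) (Fin d) ℝ) (ν : ℝ → ℝ) : ℝ≥0∞ :=
  sSup {α | ∀ (y : H1v Ω 2) (v : H10v Ω d), α * ‖v‖ₑ ^ 2 ≤ ENNReal.ofReal (formA K ν y v v)}

/-- The best constant `α̂_a` in `a_y(s, s) ≥ α̂_a ‖s‖²_{1,Ω}`, for `s ∈ H¹₀(Ω)²`. -/
def coercAy {d : ℕ} (Ω : Set (Pt d)) (D : Matrix (Fin 2) (Fin 2) ℝ) : ℝ≥0∞ :=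
  sSup {α | ∀ s : H10v Ω 2,
    α * ‖s‖ₑ ^ 2 ≤ ENNReal.ofReal (formAy D (s : H1v Ω 2) (s : H1v Ω 2))}

/-- The exponent `p₁` with `H^{3/2+δ}(Ω) ⊆ W^{1,p₁}(Ω)`: it is `4/(1-2δ)` for `d = 2` and
`3/(1-δ)` for `d = 3`. -/
def p₁ (d : ℕ) (δ : ℝ) : ℝ := 2 * d / (d - 1 - 2 * δ)

/-- The exponent `p₂` with `1/p₁ + 1/p₂ = 1/2`. -/
def p₂ (d : ℕ) (δ : ℝ) : ℝ := 2 * d / (1 + 2 * δ)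

/-- The smallness condition
`α_a > C₆ C₃ (C_{ν_T} C_{p₂} C_gn M M_y / α̂_a + M_u + C_{F_y} M_y / α̂_a)`. -/
def Smallness {d : ℕ} (Ω : Set (Pt d)) (K : Pt d → Matrix (Fin d) (Fin d) ℝ) (ν : ℝ → ℝ)
    (D : Matrix (Fin 2) (Fin 2) ℝ) (δ : ℝ) (CνT CFy Mu My M : ℝ≥0) : Prop :=
  embConst Ω 6 * embConst Ω 3 *
    (CνT * embConst Ω (ENNReal.ofReal (p₂ d δ))
        * gradEmbConst Ω (1 / 2 + δ) (ENNReal.ofReal (p₁ d δ)) * M * My / coercAy Ω D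
      + Mu + CFy * My / coercAy Ω D) < coercA Ω K ν

end DoublyDiffusive

end

open DoublyDiffusive

/-! The linearized problem is a pair of equations, each coercive in its own unknown, joined by
coupling terms small enough not to destroy coercivity.

On the diagonal, convection by `ū` contributes nothing because `div ū = 0` (`formC_self_eq_zero`).
The term `c(ψ, ū, ψ)` costs at most C₆C₃M_u, so the velocity block has coercivity constant A = a₀ −
C₆C₃M_u for any a₀ < α_a, while the block for `χ` keeps α̂_a. Off the diagonal, Hölder's inequality
bounds the viscosity and buoyancy terms by B = C_{ν_T}C_{p₂}C_{gn}M + C_{F_y}, and convection of `ȳ`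
by E = C₆C₃M_y. Since the smallness condition is strict, it leaves room for an a₀, and multiplied by
α̂_a it becomes BE < Aα̂_a.

Under this inequality the second equation can be weighted by some l > 0 so that the sum of the two
is a coercive form on the product space (`exists_weight`). Lax–Milgram then gives existence
(`coupled_laxMilgram`). The a priori bound gives uniqueness, with a constant depending only on A, B,
α̂_a, E, hence uniform in the states and in the forcing. `exists_linearized_forms` supplies the four
bounded forms with these constants.

The best constants are extended nonnegative reals. `Smallness.exists_real` turns the condition into
one between real numbers: an infinite Sobolev constant would violate it, and Poincaré's inequality
makes α̂_a positive. -/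

/-! ### Abstract well-posedness of a weakly coupled system -/

/-- A weight making a coupled quadratic form positive. -/
theorem exists_weight {A B α E : ℝ} (hA : 0 < A) (hα : 0 < α) (hB : 0 ≤ B) (hE : 0 ≤ E)
    (h : B * E < A * α) : ∃ l > 0, ∃ c > 0, ∀ x y : ℝ, 0 ≤ x → 0 ≤ y →
      c * (x ^ 2 + y ^ 2) ≤ A * x ^ 2 - B * y * x + l * (α * y ^ 2 - E * x * y) := by
  -- Negative discriminant of A x² − (B + lE) x y + lα y². The quotient (B + lE)² / l is smallest at
  -- l = B / E, with value 4BE; that choice degenerates if E = 0 or B = 0, where a large,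
  -- respectively small, l works.
  obtain ⟨l, hl, hdisc⟩ : ∃ l > 0, (B + l * E) ^ 2 < 4 * l * α * A := by
    rcases hE.eq_or_lt with rfl | hE
    · refine ⟨(B ^ 2 + 1) / (4 * α * A), by positivity, ?_⟩
      have : 4 * ((B ^ 2 + 1) / (4 * α * A)) * α * A = B ^ 2 + 1 := by field_simp
      rw [this]; linarith
    rcases hB.eq_or_lt with rfl | hB
    · refine ⟨A * α / E ^ 2, by positivity, ?_⟩
      have e1 : (0 + A * α / E ^ 2 * E) ^ 2 = (A * α) ^ 2 / E ^ 2 := by field_simp; ring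
      have e2 : 4 * (A * α / E ^ 2) * α * A = 4 * ((A * α) ^ 2 / E ^ 2) := by field_simp
      have : 0 < (A * α) ^ 2 / E ^ 2 := by positivity
      rw [e1, e2]; linarith
    · refine ⟨B / E, by positivity, ?_⟩
      have e1 : (B + B / E * E) ^ 2 = 4 * (B / E) * (B * E) := by field_simp; ring
      have e2 : 4 * (B / E) * α * A = 4 * (B / E) * (A * α) := by ring
      rw [e1, e2]
      exact mul_lt_mul_of_pos_left h (by positivity)
  set b := B + l * E with hb
  have hb0 : 0 ≤ b := by positivity
  have hs : 0 < A + l * α := by positivity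
  -- Here c is determinant over trace of the symmetric matrix of the form, a lower bound for its
  -- smaller eigenvalue: after subtracting c from the diagonal, the determinant equals c² ≥ 0.
  refine ⟨l, hl, (4 * l * α * A - b ^ 2) / (4 * (A + l * α)), ?_, fun x y hx hy => ?_⟩
  · apply div_pos <;> linarith
  set c := (4 * l * α * A - b ^ 2) / (4 * (A + l * α)) with hc
  have hcs : c * (A + l * α) = l * α * A - b ^ 2 / 4 := by rw [hc]; field_simp
  have hc0 : 0 < c := by apply div_pos <;> linarith
  have h1 : 0 < A - c := by
    by_contra! hcon
    nlinarith [mul_pos hl hα, sq_nonneg b, mul_pos hc0 hA]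
  have h2 : b ^ 2 / 4 ≤ (A - c) * (l * α - c) := by nlinarith [sq_nonneg c]
  have h3 : 0 ≤ (A - c) * ((A - c) * x ^ 2 - b * x * y + (l * α - c) * y ^ 2) := by
    nlinarith [sq_nonneg ((A - c) * x - b / 2 * y), mul_le_mul_of_nonneg_right h2 (sq_nonneg y)]
  have h4 := nonneg_of_mul_nonneg_right h3 h1
  rw [hb] at h4
  linarith

/-- A system of two equations, coercive on the diagonal and with small coupling, is well posed
with constants depending only on the bounds of the forms. -/
theorem coupled_laxMilgram (U Y : Type*) [NormedAddCommGroup U] [InnerProductSpace ℝ U]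
    [CompleteSpace U] [NormedAddCommGroup Y] [InnerProductSpace ℝ Y] [CompleteSpace Y]
    {A B α E : ℝ} (hA : 0 < A) (hα : 0 < α) (hB : 0 ≤ B) (hE : 0 ≤ E) (h : B * E < A * α) :
    ∃ C > (0 : ℝ), ∀ (a : U →L[ℝ] U →L[ℝ] ℝ) (b : Y →L[ℝ] U →L[ℝ] ℝ) (e : Y →L[ℝ] Y →L[ℝ] ℝ)
      (g : U →L[ℝ] Y →L[ℝ] ℝ), (∀ u, A * ‖u‖ ^ 2 ≤ a u u) → (∀ y u, |b y u| ≤ B * ‖y‖ * ‖u‖) →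
      (∀ y, α * ‖y‖ ^ 2 ≤ e y y) → (∀ u y, |g u y| ≤ E * ‖u‖ * ‖y‖) →
      ∀ (f₁ : StrongDual ℝ U) (f₂ : StrongDual ℝ Y),
        (∃! p : U × Y, (∀ v, a p.1 v + b p.2 v = f₁ v) ∧ ∀ s, e p.2 s + g p.1 s = f₂ s) ∧
        ∀ u y, (∀ v, a u v + b y v = f₁ v) → (∀ s, e y s + g u s = f₂ s) →
          ‖u‖ ≤ C * (‖f₁‖ + ‖f₂‖) ∧ ‖y‖ ≤ C * (‖f₁‖ + ‖f₂‖) := by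
  obtain ⟨l, hl, c, hc, hq⟩ := exists_weight hA hα hB hE h
  -- The factor 1 + l bounds the weighted data, 1 / c is the coercivity, and 2 comes from (p + q)² ≤
  -- 2 (p² + q²).
  refine ⟨(1 + l) / c * 2, by positivity, fun a b e g ha hb he hg f₁ f₂ => ?_⟩
  have key : ∀ u y, c * (‖u‖ ^ 2 + ‖y‖ ^ 2) ≤ a u u + b y u + l * (e y y + g u y) := by
    intro u y
    have h1 := neg_le_of_abs_le (hb y u)
    have h2 := neg_le_of_abs_le (hg u y)
    have h3 := hq ‖u‖ ‖y‖ (norm_nonneg _) (norm_nonneg _)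
    have h4 := mul_le_mul_of_nonneg_left (add_le_add (he y) h2) hl.le
    have := ha u
    linarith
  have bound : ∀ u y, ∀ (f₁ : StrongDual ℝ U) (f₂ : StrongDual ℝ Y),
      (∀ v, a u v + b y v = f₁ v) → (∀ s, e y s + g u s = f₂ s) →
      ‖u‖ ≤ (1 + l) / c * 2 * (‖f₁‖ + ‖f₂‖) ∧ ‖y‖ ≤ (1 + l) / c * 2 * (‖f₁‖ + ‖f₂‖) := by
    intro u y f₁ f₂ h1 h2
    have h3 := key u y
    rw [h1, h2] at h3
    have h4 : f₁ u ≤ ‖f₁‖ * ‖u‖ := (le_abs_self _).trans (f₁.le_opNorm u)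
    have h5 : f₂ y ≤ ‖f₂‖ * ‖y‖ := (le_abs_self _).trans (f₂.le_opNorm y)
    set N := ‖f₁‖ + ‖f₂‖
    have hf1 : ‖f₁‖ ≤ N := by have := norm_nonneg f₂; simp only [N]; linarith
    have hf2 : ‖f₂‖ ≤ N := by have := norm_nonneg f₁; simp only [N]; linarith
    have hN : 0 ≤ N := by positivity
    set p := ‖u‖ with hp
    set q := ‖y‖ with hq
    have hp0 : 0 ≤ p := norm_nonneg _
    have hq0 : 0 ≤ q := norm_nonneg _
    have h6 : f₁ u + l * f₂ y ≤ (1 + l) * N * (p + q) := by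
      have t1 : f₁ u ≤ N * p := h4.trans (mul_le_mul_of_nonneg_right hf1 hp0)
      have t2 : l * f₂ y ≤ l * (N * q) :=
        mul_le_mul_of_nonneg_left (h5.trans (mul_le_mul_of_nonneg_right hf2 hq0)) hl.le
      have t3 : 0 ≤ N * q := by positivity
      have t4 : 0 ≤ l * (N * p) := by positivity
      linarith
    have h7 : p + q ≤ (1 + l) / c * 2 * N := by
      rw [show (1 + l) / c * 2 * N = (2 * ((1 + l) * N)) / c by ring, le_div_iff₀ hc]
      rcases (add_nonneg hp0 hq0).eq_or_lt with h0 | h0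
      · rw [← h0, zero_mul]; positivity
      · have : c * ((p + q) ^ 2) ≤ 2 * ((1 + l) * N) * (p + q) := by
          nlinarith [sq_nonneg (p - q)]
        exact le_of_mul_le_mul_right (by linarith) h0
    exact ⟨by linarith, by linarith⟩
  refine ⟨?_, fun u y => bound u y f₁ f₂⟩
  let V := WithLp 2 (U × Y)
  let P : V →L[ℝ] U := WithLp.fstL 2 ℝ U Y
  let Q : V →L[ℝ] Y := WithLp.sndL 2 ℝ U Y
  -- The two equations added, the second with weight l. Coercivity of `T` is `key`; testing with (v,
  -- 0) and (0, s) recovers the separate equations because l ≠ 0.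
  let T : V →L[ℝ] V →L[ℝ] ℝ := a.bilinearComp P P + b.bilinearComp Q P
    + l • (e.bilinearComp Q Q + g.bilinearComp P Q)
  have hT : ∀ p q, T p q = a p.fst q.fst + b p.snd q.fst
      + l * (e p.snd q.snd + g p.fst q.snd) := fun p q => rfl
  have hco : IsCoercive T := by
    refine ⟨c, hc, fun p => ?_⟩
    have := key p.fst p.snd
    rw [hT, mul_assoc, ← pow_two, WithLp.prod_norm_sq_eq_of_L2]
    exact this
  let f : StrongDual ℝ V := f₁.comp P + l • f₂.comp Q
  let p := hco.continuousLinearEquivOfBilin.symm ((InnerProductSpace.toDual ℝ V).symm f)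
  have hp : ∀ q, T p q = f q := by
    intro q
    rw [← hco.continuousLinearEquivOfBilin_apply]
    simp [p]
  have hpf : ∀ q : V, a p.fst q.fst + b p.snd q.fst + l * (e p.snd q.snd + g p.fst q.snd)
      = f₁ q.fst + l * f₂ q.snd := fun q => by rw [← hT, hp]; rfl
  have hv : ∀ v, a p.fst v + b p.snd v = f₁ v := fun v => by
    simpa using hpf (WithLp.toLp 2 (v, 0))
  have hs : ∀ s, e p.snd s + g p.fst s = f₂ s := fun s => by
    have := hpf (WithLp.toLp 2 (0, s))
    simp only [WithLp.toLp_fst, WithLp.toLp_snd, map_zero, zero_add] at this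
    exact mul_left_cancel₀ hl.ne' this
  refine ⟨(p.fst, p.snd), ⟨hv, hs⟩, ?_⟩
  rintro ⟨u, y⟩ ⟨h1, h2⟩
  -- The difference of two solutions solves the system with zero data, so the a priori bound forces
  -- it to vanish.
  have := bound (u - p.fst) (y - p.snd) 0 0
    (fun v => by
      have := h1 v; have := hv v
      simp only [map_sub, sub_apply, zero_apply]; linarith)
    (fun v => by
      have := h2 v; have := hs v
      simp only [map_sub, sub_apply, zero_apply]; linarith)
  simp only [norm_zero, add_zero, mul_zero, norm_le_zero_iff, sub_eq_zero] at this
  exact Prod.ext this.1 this.2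

/-- The well-posedness result `coupled_laxMilgram` on closed subspaces, for norms satisfying the
parallelogram identity. -/
theorem coupled_laxMilgram_submodule {V W : Type*} [NormedAddCommGroup V] [NormedSpace ℝ V]
    [NormedAddCommGroup W] [NormedSpace ℝ W] (P : Submodule ℝ V) (R : Submodule ℝ W)
    [CompleteSpace P] [CompleteSpace R]
    (hV : ∀ x y : V, ‖x + y‖ * ‖x + y‖ + ‖x - y‖ * ‖x - y‖ = 2 * (‖x‖ * ‖x‖ + ‖y‖ * ‖y‖))
    (hW : ∀ x y : W, ‖x + y‖ * ‖x + y‖ + ‖x - y‖ * ‖x - y‖ = 2 * (‖x‖ * ‖x‖ + ‖y‖ * ‖y‖))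
    {A B α E : ℝ} (hA : 0 < A) (hα : 0 < α) (hB : 0 ≤ B) (hE : 0 ≤ E) (h : B * E < A * α) :
    ∃ C > (0 : ℝ), ∀ (a : V →L[ℝ] V →L[ℝ] ℝ) (b : W →L[ℝ] V →L[ℝ] ℝ) (e : W →L[ℝ] W →L[ℝ] ℝ)
      (g : V →L[ℝ] W →L[ℝ] ℝ), (∀ u ∈ P, A * ‖u‖ ^ 2 ≤ a u u) →
      (∀ y u, |b y u| ≤ B * ‖y‖ * ‖u‖) → (∀ y ∈ R, α * ‖y‖ ^ 2 ≤ e y y) →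
      (∀ u y, |g u y| ≤ E * ‖u‖ * ‖y‖) → ∀ (f₁ : StrongDual ℝ P) (f₂ : StrongDual ℝ R),
        (∃! p : P × R, (∀ v : P, a p.1 v + b p.2 v = f₁ v) ∧ ∀ s : R, e p.2 s + g p.1 s = f₂ s) ∧
        ∀ (u : P) (y : R), (∀ v : P, a u v + b y v = f₁ v) → (∀ s : R, e y s + g u s = f₂ s) →
          ‖u‖ ≤ C * (‖f₁‖ + ‖f₂‖) ∧ ‖y‖ ≤ C * (‖f₁‖ + ‖f₂‖) := by
  -- The conclusion involves only norms, so any inner product inducing them will do; the Jordan–von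
  -- Neumann theorem provides one.
  obtain ⟨C, hC, key⟩ := @coupled_laxMilgram P R _ (InnerProductSpace.ofNorm ℝ
    fun x y => hV x y) _ _ (InnerProductSpace.ofNorm ℝ fun x y => hW x y) _ A B α E hA hα hB hE h
  refine ⟨C, hC, fun a b e g ha hb he hg f₁ f₂ => ?_⟩
  exact key (a.bilinearComp P.subtypeL P.subtypeL) (b.bilinearComp R.subtypeL P.subtypeL)
    (e.bilinearComp R.subtypeL R.subtypeL) (g.bilinearComp P.subtypeL R.subtypeL)
    (fun u => ha u u.2) (fun y u => hb y u) (fun y => he y y.2) (fun u y => hg u y) f₁ f₂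

/-! ### Integral bilinear forms and Hölder's inequality -/

/-- An integral depending bilinearly and boundedly on two arguments is a continuous bilinear
form. -/
theorem exists_continuousBilin {U V α : Type*} [NormedAddCommGroup U] [NormedSpace ℝ U]
    [NormedAddCommGroup V] [NormedSpace ℝ V] [MeasurableSpace α] {μ : Measure α}
    (f : U → V → α → ℝ)
    (hal : ∀ u u' v, f (u + u') v =ᵐ[μ] f u v + f u' v)
    (hsl : ∀ (c : ℝ) u v, f (c • u) v =ᵐ[μ] c • f u v)
    (har : ∀ u v v', f u (v + v') =ᵐ[μ] f u v + f u v')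
    (hsr : ∀ (c : ℝ) u v, f u (c • v) =ᵐ[μ] c • f u v)
    (hm : ∀ u v, AEStronglyMeasurable (f u v) μ) (C : ℝ≥0)
    (hb : ∀ u v, ∫⁻ x, ‖f u v x‖ₑ ∂μ ≤ C * ‖u‖ₑ * ‖v‖ₑ) :
    ∃ T : U →L[ℝ] V →L[ℝ] ℝ, (∀ u v, T u v = ∫ x, f u v x ∂μ) ∧
      (∀ u v, |T u v| ≤ C * ‖u‖ * ‖v‖) ∧ ∀ u v, Integrable (f u v) μ := by
  have hi : ∀ u v, Integrable (f u v) μ := fun u v =>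
    ⟨hm u v, (hb u v).trans_lt (by finiteness)⟩
  have hbd : ∀ u v, ‖∫ x, f u v x ∂μ‖ ≤ C * ‖u‖ * ‖v‖ := by
    intro u v
    have h1 := (enorm_integral_le_lintegral_enorm (f u v)).trans (hb u v)
    rw [enorm_eq_nnnorm, enorm_eq_nnnorm, enorm_eq_nnnorm] at h1
    exact_mod_cast h1
  let T₀ : U →ₗ[ℝ] V →ₗ[ℝ] ℝ := LinearMap.mk₂ ℝ (fun u v => ∫ x, f u v x ∂μ)
    (fun u u' v => by
      rw [integral_congr_ae (hal u u' v)]; exact integral_add (hi _ _) (hi _ _))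
    (fun c u v => by
      rw [integral_congr_ae (hsl c u v)]; exact integral_const_mul _ _)
    (fun u v v' => by
      rw [integral_congr_ae (har u v v')]; exact integral_add (hi _ _) (hi _ _))
    (fun c u v => by
      rw [integral_congr_ae (hsr c u v)]; exact integral_const_mul _ _)
  exact ⟨T₀.mkContinuous₂ C hbd, fun u v => rfl, hbd, hi⟩

/-- Hölder twice: the product of the first two factors lies in L², and is then paired with the
third. -/
theorem lintegral_enorm_mul_mul_le {α E₁ E₂ E₃ : Type*} [MeasurableSpace α] {μ : Measure α}
    [NormedAddCommGroup E₁] [NormedAddCommGroup E₂] [NormedAddCommGroup E₃]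
    {f : α → E₁} {g : α → E₂} {h : α → E₃} (hf : AEStronglyMeasurable f μ)
    (hg : AEStronglyMeasurable g μ) (hh : AEStronglyMeasurable h μ) (p r : ℝ≥0∞)
    [ENNReal.HolderTriple p r 2] :
    ∫⁻ x, ‖f x‖ₑ * ‖g x‖ₑ * ‖h x‖ₑ ∂μ ≤ eLpNorm f p μ * eLpNorm g r μ * eLpNorm h 2 μ := by
  have h1 : eLpNorm (fun x => ‖f x‖ * ‖g x‖) 2 μ ≤ eLpNorm f p μ * eLpNorm g r μ := by
    simpa using eLpNorm_le_eLpNorm_mul_eLpNorm_of_nnnorm (r := 2) hf hg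
      (fun a b => ‖a‖ * ‖b‖) 1 (by simp)
  have h2 := eLpNorm_le_eLpNorm_mul_eLpNorm_of_nnnorm (p := 2) (q := 2) (r := 1)
      (hf.norm.mul hg.norm) hh (fun a b => a * ‖b‖) 1 (by simp)
  rw [eLpNorm_one_eq_lintegral_enorm] at h2
  simp only [Pi.mul_apply, enorm_mul, enorm_norm, ENNReal.coe_one, one_mul] at h2
  exact h2.trans (mul_le_mul_left h1 _)

theorem lintegral_enorm_mul_le {α E₁ E₂ : Type*} [MeasurableSpace α] {μ : Measure α}
    [NormedAddCommGroup E₁] [NormedAddCommGroup E₂]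
    {f : α → E₁} {g : α → E₂} (hf : AEStronglyMeasurable f μ)
    (hg : AEStronglyMeasurable g μ) :
    ∫⁻ x, ‖f x‖ₑ * ‖g x‖ₑ ∂μ ≤ eLpNorm f 2 μ * eLpNorm g 2 μ := by
  have h2 := eLpNorm_le_eLpNorm_mul_eLpNorm_of_nnnorm (p := 2) (q := 2) (r := 1)
      hf hg (fun a b => ‖a‖ * ‖b‖) 1 (by simp)
  rw [eLpNorm_one_eq_lintegral_enorm] at h2
  simpa only [enorm_mul, enorm_norm, ENNReal.coe_one, one_mul] using h2

theorem eLpNorm_two_sq {α E : Type*} [MeasurableSpace α] {μ : Measure α}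
    [NormedAddCommGroup E] (g : α → E) : eLpNorm g 2 μ ^ 2 = ∫⁻ x, ‖g x‖ₑ ^ 2 ∂μ := by
  simpa using eLpNorm_nnreal_pow_eq_lintegral (f := g) (μ := μ) (p := 2) (by norm_num)

theorem eLpNorm_toLp_sq {α ι : Type*} [Fintype ι] [MeasurableSpace α] {μ : Measure α}
    (f : ι → α → ℝ) (hf : ∀ i, AEStronglyMeasurable (f i) μ) :
    eLpNorm (fun x => WithLp.toLp 2 (fun i => f i x) : α → EuclideanSpace ℝ ι) 2 μ ^ 2
      = ∑ i, eLpNorm (f i) 2 μ ^ 2 := by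
  simp only [eLpNorm_two_sq]
  rw [← lintegral_finsetSum' _ (fun i _ => (hf i).enorm.pow_const 2)]
  refine lintegral_congr fun x => ?_
  rw [← ofReal_norm, ← ENNReal.ofReal_pow (norm_nonneg _), EuclideanSpace.norm_sq_eq,
    ENNReal.ofReal_sum_of_nonneg (fun i _ => by positivity)]
  refine Finset.sum_congr rfl fun i _ => ?_
  rw [ENNReal.ofReal_pow (norm_nonneg _), ofReal_norm]

namespace DoublyDiffusive

/-! ### Measurability and the norm of `H¹(Ω)^m` -/

variable {d m : ℕ} {Ω : Set (Pt d)}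

/-- The gradient as a Euclidean vector, so that its norm is the Frobenius norm. -/
noncomputable def gradVec (w : H1v Ω m) (x : Pt d) : EuclideanSpace ℝ (Fin m × Fin d) :=
  WithLp.toLp 2 (fun p => grad w p.1 p.2 x)

theorem norm_gradVec (w : H1v Ω m) (x : Pt d) :
    ‖gradVec w x‖ = √(∑ j, ∑ i, grad w j i x ^ 2) := by
  simp [gradVec, EuclideanSpace.norm_eq, Fintype.sum_prod_type]

theorem gradLpNorm_eq (p : ℝ≥0∞) (w : H1v Ω m) :
    gradLpNorm p w = eLpNorm (gradVec w) p (volume.restrict Ω) := by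
  rw [← eLpNorm_norm (gradVec w)]
  simp only [norm_gradVec]; rfl

theorem aesm_val_apply (w : H1v Ω m) (j : Fin m) :
    AEStronglyMeasurable (fun x => val w x j) (volume.restrict Ω) :=
  Lp.aestronglyMeasurable ((w j : Jet Ω) none)

theorem aesm_grad (w : H1v Ω m) (j : Fin m) (i : Fin d) :
    AEStronglyMeasurable (grad w j i) (volume.restrict Ω) :=
  Lp.aestronglyMeasurable ((w j : Jet Ω) (some i))

theorem aesm_val (w : H1v Ω m) : AEStronglyMeasurable (val w) (volume.restrict Ω) :=
  (PiLp.continuous_toLp 2 _).comp_aestronglyMeasurable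
    (aemeasurable_pi_lambda _ fun j => (aesm_val_apply w j).aemeasurable).aestronglyMeasurable

theorem aesm_gradVec (w : H1v Ω m) : AEStronglyMeasurable (gradVec w) (volume.restrict Ω) :=
  (PiLp.continuous_toLp 2 _).comp_aestronglyMeasurable
    (aemeasurable_pi_lambda _ fun p : Fin m × Fin d => (aesm_grad w p.1 p.2).aemeasurable).aestronglyMeasurable

theorem norm_sq_H1v (w : H1v Ω m) : ‖w‖ ^ 2 =
    ∑ j, (‖(w j : Jet Ω) none‖ ^ 2 + ∑ i, ‖(w j : Jet Ω) (some i)‖ ^ 2) := by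
  rw [PiLp.norm_sq_eq_of_L2]
  refine Finset.sum_congr rfl fun j _ => ?_
  rw [Submodule.coe_norm, PiLp.norm_sq_eq_of_L2, Fintype.sum_option]

/-- Links the nested Hilbert norm to the L² norms of value and gradient as Euclidean vectors. It
follows that both L² norms are bounded by the H¹ norm with constant 1, so no extra factor enters the
smallness condition. -/
theorem enorm_sq_H1v (w : H1v Ω m) :
    ‖w‖ₑ ^ 2 = lpNorm 2 w ^ 2 + gradLpNorm 2 w ^ 2 := by
  rw [gradLpNorm_eq, lpNorm]
  have h1 := eLpNorm_toLp_sq (μ := volume.restrict Ω) (fun j x => val w x j) (aesm_val_apply w)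
  have h2 := eLpNorm_toLp_sq (μ := volume.restrict Ω) (fun (p : Fin m × Fin d) x =>
    grad w p.1 p.2 x) (fun p => aesm_grad w p.1 p.2)
  have h3 : ‖w‖ₑ ^ 2 = ∑ j, (‖(w j : Jet Ω) none‖ₑ ^ 2 + ∑ i, ‖(w j : Jet Ω) (some i)‖ₑ ^ 2) := by
    have := norm_sq_H1v w
    simp only [enorm_eq_nnnorm]
    norm_cast
    rw [← NNReal.coe_inj]
    push_cast
    exact this
  refine h3.trans ?_
  rw [Finset.sum_add_distrib]
  congr 1
  · refine Eq.trans ?_ h1.symm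
    simp only [Lp.enorm_def]; rfl
  · refine Eq.trans ?_ h2.symm
    rw [Fintype.sum_prod_type]
    simp only [Lp.enorm_def]; rfl

theorem lpNorm_two_le (w : H1v Ω m) : lpNorm 2 w ≤ ‖w‖ₑ := by
  rw [← ENNReal.pow_le_pow_left_iff two_ne_zero, enorm_sq_H1v]
  exact le_self_add

theorem gradLpNorm_two_le (w : H1v Ω m) : gradLpNorm 2 w ≤ ‖w‖ₑ := by
  rw [← ENNReal.pow_le_pow_left_iff two_ne_zero, enorm_sq_H1v]
  exact le_add_self

/-! ### Linearity of values and gradients -/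

theorem val_add (u v : H1v Ω m) : ∀ᵐ x ∂volume.restrict Ω, ∀ j,
    val (u + v) x j = val u x j + val v x j := by
  rw [ae_all_iff]
  exact fun j => Lp.coeFn_add ((u j : Jet Ω) none) ((v j : Jet Ω) none)

theorem val_smul (c : ℝ) (u : H1v Ω m) : ∀ᵐ x ∂volume.restrict Ω, ∀ j,
    val (c • u) x j = c * val u x j := by
  rw [ae_all_iff]
  exact fun j => Lp.coeFn_smul c ((u j : Jet Ω) none)

theorem grad_add (u v : H1v Ω m) : ∀ᵐ x ∂volume.restrict Ω, ∀ j i,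
    grad (u + v) j i x = grad u j i x + grad v j i x := by
  simp only [ae_all_iff]
  exact fun j i => Lp.coeFn_add ((u j : Jet Ω) (some i)) ((v j : Jet Ω) (some i))

theorem grad_smul (c : ℝ) (u : H1v Ω m) : ∀ᵐ x ∂volume.restrict Ω, ∀ j i,
    grad (c • u) j i x = c * grad u j i x := by
  simp only [ae_all_iff]
  exact fun j i => Lp.coeFn_smul c ((u j : Jet Ω) (some i))

/-! ### Embedding constants -/

/-- A best constant is itself admissible, since it is the supremum of the quotients a / b. Indices
with b = 0 are separate: there ∞ · 0 = 0, so a must vanish too. -/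
theorem le_sInf_mul {ι : Type*} {P : ι → Prop} {a b : ι → ℝ≥0∞} (i : ι) (hi : P i)
    (h0 : b i = 0 → a i = 0) (hb : b i ≠ ⊤) :
    a i ≤ sInf {C | ∀ i, P i → a i ≤ C * b i} * b i := by
  rcases eq_or_ne (b i) 0 with h | h
  · simp [h0 h]
  · rw [← ENNReal.div_le_iff_le_mul (Or.inl h) (Or.inl hb)]
    exact le_sInf fun C hC => (ENNReal.div_le_iff_le_mul (Or.inl h) (Or.inl hb)).2 (hC i hi)

theorem lpNorm_zero (p : ℝ≥0∞) : lpNorm p (0 : H1v Ω m) = 0 := by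
  have : val (0 : H1v Ω m) =ᵐ[volume.restrict Ω] 0 := by
    have h : ∀ᵐ x ∂volume.restrict Ω, ∀ j, val (0 : H1v Ω m) x j = 0 := by
      rw [ae_all_iff]
      exact fun j => Lp.coeFn_zero ℝ 2 _
    filter_upwards [h] with x hx
    ext j; exact hx j
  rw [lpNorm, eLpNorm_congr_ae this, eLpNorm_zero]

theorem lpNorm_le_embConst_self (p : ℝ≥0∞) (w : H1v Ω d) :
    lpNorm p w ≤ embConst Ω p * ‖w‖ₑ := by
  have := le_sInf_mul (P := fun _ => True) (a := fun w : H1v Ω d => lpNorm p w)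
    (b := fun w => ‖w‖ₑ) w trivial
    (fun h => by
      rw [← ofReal_norm, ENNReal.ofReal_eq_zero, norm_le_zero_iff] at h
      rw [h]; exact lpNorm_zero p) enorm_ne_top
  simpa [embConst] using this

/-- The embedding constants are defined through `d`-component fields. Padding with zero components
changes neither norm, so they also serve the two-component fields (T, S). -/
theorem lpNorm_le_embConst (hmd : m ≤ d) (p : ℝ≥0∞) (w : H1v Ω m) :
    lpNorm p w ≤ embConst Ω p * ‖w‖ₑ := by
  obtain ⟨k, rfl⟩ := Nat.exists_eq_add_of_le hmd
  let w' : H1v Ω (m + k) := WithLp.toLp 2 (Fin.addCases (fun j => w j) (fun _ => 0))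
  have h1 : ‖w'‖ₑ = ‖w‖ₑ := by
    have : ‖w'‖ = ‖w‖ := by
      rw [← sq_eq_sq₀ (norm_nonneg _) (norm_nonneg _), PiLp.norm_sq_eq_of_L2,
        PiLp.norm_sq_eq_of_L2, Fin.sum_univ_add]
      simp [w']
    rw [← ofReal_norm, this, ofReal_norm]
  have h2 : lpNorm p w' = lpNorm p w := by
    refine eLpNorm_congr_norm_ae ?_
    filter_upwards [Lp.coeFn_zero ℝ 2 (volume.restrict Ω)] with x hx
    rw [← sq_eq_sq₀ (norm_nonneg _) (norm_nonneg _), EuclideanSpace.norm_sq_eq,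
        EuclideanSpace.norm_sq_eq, Fin.sum_univ_add]
    have : ∀ i : Fin k, val w' x (Fin.natAdd m i) = 0 := fun i => by
      simpa [val, w'] using hx
    simp [this]
    simp [val, w']
  rw [← h1, ← h2]
  exact lpNorm_le_embConst_self p w'

theorem gradLpNorm_le_gradEmbConst {σ : ℝ} (p : ℝ≥0∞) (w : H1v Ω d) (hw : MemFrac σ w) :
    gradLpNorm p w ≤ gradEmbConst Ω σ p * fracNorm σ w := by
  refine le_sInf_mul (P := fun w : H1v Ω d => MemFrac σ w) (a := fun w : H1v Ω d => gradLpNorm p w)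
    (b := fun w => fracNorm σ w) w hw (fun h => ?_) (ne_of_lt hw)
  have h1 : gradLpNorm 2 w = 0 := by
    have : ‖w‖ₑ = 0 := by
      simp only [fracNorm, ENNReal.rpow_eq_zero_iff] at h
      norm_num at h
      simp [h.1]
    simpa [this] using gradLpNorm_two_le w
  rw [gradLpNorm_eq] at h1 ⊢
  rw [eLpNorm_eq_zero_iff (aesm_gradVec w) (by norm_num)] at h1
  rw [eLpNorm_congr_ae h1, eLpNorm_zero]

/-! ### The forms as continuous bilinear forms -/

theorem abs_sum_grad_le (u v : H1v Ω m) (x : Pt d) :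
    |∑ j, ∑ i, grad u j i x * grad v j i x| ≤ ‖gradVec u x‖ * ‖gradVec v x‖ := by
  have h := abs_real_inner_le_norm (gradVec v x) (gradVec u x)
  simp only [PiLp.inner_apply, Fintype.sum_prod_type] at h
  rw [mul_comm]
  simpa [gradVec] using h

/-- Cauchy–Schwarz for the Frobenius product of ∇u with the rank-one matrix v ⊗ w, whose norm is
|v||w|; hence no dimensional factor. -/
theorem abs_convection_le (w : H1v Ω d) (u v : H1v Ω m) (x : Pt d) :
    |∑ j, (∑ i, val w x i * grad u j i x) * val v x j|
      ≤ ‖val w x‖ * ‖val v x‖ * ‖gradVec u x‖ := by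
  let z : EuclideanSpace ℝ (Fin m × Fin d) := WithLp.toLp 2 (fun p => val v x p.1 * val w x p.2)
  have hz : ‖z‖ = ‖val w x‖ * ‖val v x‖ := by
    rw [← sq_eq_sq₀ (norm_nonneg _) (by positivity), mul_pow, EuclideanSpace.norm_sq_eq,
      EuclideanSpace.norm_sq_eq, EuclideanSpace.norm_sq_eq, Fintype.sum_prod_type, mul_comm,
      Finset.sum_mul_sum]
    simp [z, mul_pow]
  have h := abs_real_inner_le_norm z (gradVec u x)
  rw [hz] at h
  refine le_trans (le_of_eq ?_) h
  congr 1
  simp only [PiLp.inner_apply, Fintype.sum_prod_type]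
  refine Finset.sum_congr rfl fun j _ => ?_
  rw [Finset.sum_mul]
  refine Finset.sum_congr rfl fun i _ => ?_
  simp [z, gradVec]; ring

theorem enorm_le_of_abs_le {a b : ℝ} (h : |a| ≤ b) : ‖a‖ₑ ≤ ‖b‖ₑ := by
  rw [← ofReal_norm, ← ofReal_norm]
  exact ENNReal.ofReal_le_ofReal (h.trans (le_abs_self b))

theorem aesm_convection (w : H1v Ω d) (u v : H1v Ω m) :
    AEStronglyMeasurable (fun x => ∑ j, (∑ i, val w x i * grad u j i x) * val v x j)
      (volume.restrict Ω) :=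
  Finset.aestronglyMeasurable_fun_sum _ fun j _ =>
    (Finset.aestronglyMeasurable_fun_sum _ fun i _ =>
      (aesm_val_apply w i).mul (aesm_grad u j i)).mul (aesm_val_apply v j)

instance holderTriple_six_three_two : ENNReal.HolderTriple 6 3 2 := ⟨by
  rw [← ENNReal.toReal_eq_toReal_iff' (by simp) (by simp), ENNReal.toReal_add (by simp) (by simp)]
  norm_num⟩

/-- Exponents 6, 3, 2 for w, v, ∇u, as 1/6 + 1/3 = 1/2; this is the origin of C₆C₃. -/
theorem lintegral_convection_le (hmd : m ≤ d) (w : H1v Ω d) (u v : H1v Ω m) :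
    ∫⁻ x in Ω, ‖∑ j, (∑ i, val w x i * grad u j i x) * val v x j‖ₑ
      ≤ embConst Ω 6 * embConst Ω 3 * ‖w‖ₑ * ‖u‖ₑ * ‖v‖ₑ := by
  calc _ ≤ ∫⁻ x in Ω, ‖val w x‖ₑ * ‖val v x‖ₑ * ‖gradVec u x‖ₑ := by
        refine lintegral_mono fun x => ?_
        refine (enorm_le_of_abs_le (abs_convection_le w u v x)).trans ?_
        simp only [enorm_mul, enorm_norm, le_refl]
    _ ≤ eLpNorm (val w) 6 (volume.restrict Ω) * eLpNorm (val v) 3 (volume.restrict Ω)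
        * eLpNorm (gradVec u) 2 (volume.restrict Ω) :=
        lintegral_enorm_mul_mul_le (aesm_val w) (aesm_val v) (aesm_gradVec u) 6 3
    _ ≤ (embConst Ω 6 * ‖w‖ₑ) * (embConst Ω 3 * ‖v‖ₑ) * ‖u‖ₑ := by
        refine mul_le_mul' (mul_le_mul' ?_ ?_) ?_
        · exact lpNorm_le_embConst le_rfl 6 w
        · exact lpNorm_le_embConst hmd 3 v
        · rw [← gradLpNorm_eq]; exact gradLpNorm_two_le u
    _ = _ := by ring

/-- For a fixed transporting field. Only boundedness and integrability are recorded, since the form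
will be evaluated on the diagonal, where it vanishes. -/
theorem formC_bilin_right (hmd : m ≤ d) {C : ℝ≥0} (hC : embConst Ω 6 * embConst Ω 3 ≤ C)
    (w : H1v Ω d) : ∃ T : H1v Ω m →L[ℝ] H1v Ω m →L[ℝ] ℝ, (∀ u v, T u v = formC w u v) ∧
      ∀ u v : H1v Ω m, Integrable (fun x => ∑ j, (∑ i, val w x i * grad u j i x) * val v x j)
        (volume.restrict Ω) := by
  obtain ⟨T, h1, -, h3⟩ := exists_continuousBilin (μ := volume.restrict Ω)
    (fun (u v : H1v Ω m) x => ∑ j, (∑ i, val w x i * grad u j i x) * val v x j)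
    (fun u u' v => by
      filter_upwards [grad_add u u'] with x h
      simp [h, mul_add, add_mul, Finset.sum_add_distrib])
    (fun c u v => by
      filter_upwards [grad_smul c u] with x h
      simp [h, Finset.mul_sum, Finset.sum_mul, mul_assoc, mul_left_comm])
    (fun u v v' => by
      filter_upwards [val_add v v'] with x h
      simp [h, mul_add, Finset.sum_add_distrib])
    (fun c u v => by
      filter_upwards [val_smul c v] with x h
      simp [h, Finset.mul_sum, mul_left_comm])
    (fun u v => aesm_convection w u v) (C * ‖w‖₊) (fun u v => by
      refine (lintegral_convection_le hmd w u v).trans ?_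
      rw [ENNReal.coe_mul, ← enorm_eq_nnnorm]
      gcongr)
  exact ⟨T, h1, h3⟩

/-- For a fixed transported field. The explicit bound is where M_u (u = ū) and M_y (u = ȳ) enter. -/
theorem formC_bilin_outer (hmd : m ≤ d) {C : ℝ≥0} (hC : embConst Ω 6 * embConst Ω 3 ≤ C)
    (u : H1v Ω m) : ∃ T : H1v Ω d →L[ℝ] H1v Ω m →L[ℝ] ℝ, (∀ w v, T w v = formC w u v) ∧
      ∀ w v, |T w v| ≤ C * ‖u‖ * ‖w‖ * ‖v‖ := by
  obtain ⟨T, h1, h2, -⟩ := exists_continuousBilin (μ := volume.restrict Ω)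
    (fun (w : H1v Ω d) (v : H1v Ω m) x => ∑ j, (∑ i, val w x i * grad u j i x) * val v x j)
    (fun w w' v => by
      filter_upwards [val_add w w'] with x h
      simp [h, add_mul, Finset.sum_add_distrib])
    (fun c w v => by
      filter_upwards [val_smul c w] with x h
      simp [h, Finset.mul_sum, Finset.sum_mul, mul_assoc])
    (fun w v v' => by
      filter_upwards [val_add v v'] with x h
      simp [h, mul_add, Finset.sum_add_distrib])
    (fun c w v => by
      filter_upwards [val_smul c v] with x h
      simp [h, Finset.mul_sum, mul_left_comm])
    (fun w v => aesm_convection w u v) (C * ‖u‖₊) (fun w v => by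
      refine (lintegral_convection_le hmd w u v).trans ?_
      rw [ENNReal.coe_mul, ← enorm_eq_nnnorm, mul_right_comm _ ‖w‖ₑ ‖u‖ₑ]
      gcongr)
  exact ⟨T, h1, h2⟩

theorem weighted_grad_bilin {ρ : Pt d → ℝ} (hρ : AEStronglyMeasurable ρ (volume.restrict Ω))
    {C : ℝ≥0} (hC : ∀ x, |ρ x| ≤ C) : ∃ T : H1v Ω m →L[ℝ] H1v Ω m →L[ℝ] ℝ,
      ∀ u v, T u v = ∫ x in Ω, ρ x * ∑ j, ∑ i, grad u j i x * grad v j i x := by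
  obtain ⟨T, h1, -, -⟩ := exists_continuousBilin (μ := volume.restrict Ω)
    (fun (u v : H1v Ω m) x => ρ x * ∑ j, ∑ i, grad u j i x * grad v j i x)
    (fun w w' v => by
      filter_upwards [grad_add w w'] with x h
      simp [h, add_mul, mul_add, Finset.sum_add_distrib])
    (fun c w v => by
      filter_upwards [grad_smul c w] with x h
      simp [h, Finset.mul_sum, mul_assoc, mul_left_comm])
    (fun w v v' => by
      filter_upwards [grad_add v v'] with x h
      simp [h, mul_add, Finset.sum_add_distrib])
    (fun c w v => by
      filter_upwards [grad_smul c v] with x h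
      simp [h, Finset.mul_sum, mul_left_comm])
    (fun u v => hρ.mul (Finset.aestronglyMeasurable_fun_sum _ fun j _ =>
      Finset.aestronglyMeasurable_fun_sum _ fun i _ => (aesm_grad u j i).mul (aesm_grad v j i)))
    C (fun u v => by
      calc _ ≤ ∫⁻ x in Ω, C * (‖gradVec u x‖ₑ * ‖gradVec v x‖ₑ) := by
            refine lintegral_mono fun x => ?_
            rw [enorm_mul]
            refine mul_le_mul' ?_ ?_
            · refine (enorm_le_of_abs_le (hC x)).trans (by simp)
            · refine (enorm_le_of_abs_le (abs_sum_grad_le u v x)).trans ?_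
              simp only [enorm_mul, enorm_norm, le_refl]
        _ = C * ∫⁻ x in Ω, (‖gradVec u x‖ₑ * ‖gradVec v x‖ₑ) :=
            lintegral_const_mul' _ _ ENNReal.coe_ne_top
        _ ≤ C * (‖u‖ₑ * ‖v‖ₑ) := by
            gcongr
            refine (lintegral_enorm_mul_le (aesm_gradVec u) (aesm_gradVec v)).trans ?_
            rw [← gradLpNorm_eq, ← gradLpNorm_eq]
            exact mul_le_mul' (gradLpNorm_two_le u) (gradLpNorm_two_le v)
        _ = _ := by ring)
  exact ⟨T, h1⟩

theorem weighted_val_bilin {κ : Pt d → Matrix (Fin d) (Fin d) ℝ}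
    (hκ : ∀ i j, AEStronglyMeasurable (fun x => κ x i j) (volume.restrict Ω))
    {C : ℝ≥0} (hC : ∀ᵐ x ∂volume.restrict Ω, ∀ i j, |κ x i j| ≤ C) :
    ∃ T : H1v Ω d →L[ℝ] H1v Ω d →L[ℝ] ℝ,
      ∀ u v, T u v = ∫ x in Ω, ∑ i, ∑ j, κ x i j * val u x j * val v x i := by
  obtain ⟨T, h1, -, -⟩ := exists_continuousBilin (μ := volume.restrict Ω)
    (fun (u v : H1v Ω d) x => ∑ i, ∑ j, κ x i j * val u x j * val v x i)
    (fun w w' v => by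
      filter_upwards [val_add w w'] with x h
      simp [h, add_mul, mul_add, Finset.sum_add_distrib])
    (fun c w v => by
      filter_upwards [val_smul c w] with x h
      simp [h, Finset.mul_sum, mul_assoc, mul_left_comm])
    (fun w v v' => by
      filter_upwards [val_add v v'] with x h
      simp [h, mul_add, Finset.sum_add_distrib])
    (fun c w v => by
      filter_upwards [val_smul c v] with x h
      simp [h, Finset.mul_sum, mul_left_comm])
    (fun u v => Finset.aestronglyMeasurable_fun_sum _ fun i _ =>
      Finset.aestronglyMeasurable_fun_sum _ fun j _ =>
        ((hκ i j).mul (aesm_val_apply u j)).mul (aesm_val_apply v i))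
    (d * d * C) (fun u v => by
      calc _ ≤ ∫⁻ x in Ω, (d * d * C : ℝ≥0) * (‖val u x‖ₑ * ‖val v x‖ₑ) := by
            refine lintegral_mono_ae ?_
            filter_upwards [hC] with x hx
            have hp : |∑ i, ∑ j, κ x i j * val u x j * val v x i|
                ≤ (d * d * C) * (‖val u x‖ * ‖val v x‖) := by
              calc _ ≤ ∑ i : Fin d, ∑ j : Fin d, (C : ℝ) * ‖val u x‖ * ‖val v x‖ := by
                    refine (Finset.abs_sum_le_sum_abs _ _).trans (Finset.sum_le_sum fun i _ =>
                      (Finset.abs_sum_le_sum_abs _ _).trans (Finset.sum_le_sum fun j _ => ?_))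
                    rw [abs_mul, abs_mul]
                    gcongr
                    · exact hx i j
                    · exact PiLp.norm_apply_le (val u x) j
                    · exact PiLp.norm_apply_le (val v x) i
                _ = _ := by simp; ring
            refine (enorm_le_of_abs_le hp).trans (le_of_eq ?_)
            simp [enorm_mul]
        _ = (d * d * C : ℝ≥0) * ∫⁻ x in Ω, (‖val u x‖ₑ * ‖val v x‖ₑ) :=
            lintegral_const_mul' _ _ ENNReal.coe_ne_top
        _ ≤ (d * d * C : ℝ≥0) * (‖u‖ₑ * ‖v‖ₑ) := by
            gcongr
            refine (lintegral_enorm_mul_le (aesm_val u) (aesm_val v)).trans ?_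
            exact mul_le_mul' (lpNorm_two_le u) (lpNorm_two_le v)
        _ = _ := by ring)
  exact ⟨T, h1⟩

theorem formFy_bilin {F : Pt 2 → Pt d} (hF : ContDiff ℝ 2 F) {C : ℝ≥0}
    (hC : ∀ z, ‖fderiv ℝ F z‖ ≤ C) (y : H1v Ω 2) :
    ∃ T : H1v Ω 2 →L[ℝ] H1v Ω d →L[ℝ] ℝ, (∀ χ v, T χ v = formFy F y χ v) ∧
      ∀ χ v, |T χ v| ≤ C * ‖χ‖ * ‖v‖ := by
  have e : ∀ {n : ℕ} {a b c : Pt n}, (∀ j, a j = b j + c j) → a = b + c := fun h => by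
    ext j; exact h j
  have e' : ∀ {n : ℕ} {a b : Pt n} {c : ℝ}, (∀ j, a j = c * b j) → a = c • b := fun h => by
    ext j; exact h j
  have hcont : Continuous fun p : Pt 2 × Pt 2 => fderiv ℝ F p.1 p.2 :=
    ((hF.continuous_fderiv (by norm_num)).comp continuous_fst).clm_apply continuous_snd
  obtain ⟨T, h1, h2, -⟩ := exists_continuousBilin (μ := volume.restrict Ω)
    (fun (χ : H1v Ω 2) (v : H1v Ω d) x => inner ℝ (fderiv ℝ F (val y x) (val χ x)) (val v x))
    (fun w w' v => by
      filter_upwards [val_add w w'] with x h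
      simp [e h, inner_add_left])
    (fun c w v => by
      filter_upwards [val_smul c w] with x h
      simp [e' h, inner_smul_left])
    (fun w v v' => by
      filter_upwards [val_add v v'] with x h
      simp [e h, inner_add_right])
    (fun c w v => by
      filter_upwards [val_smul c v] with x h
      simp [e' h, inner_smul_right])
    (fun χ v => (hcont.comp_aestronglyMeasurable
      ((aesm_val y).prodMk (aesm_val χ))).inner (aesm_val v))
    C (fun u v => by
      calc _ ≤ ∫⁻ x in Ω, C * (‖val u x‖ₑ * ‖val v x‖ₑ) := by
            refine lintegral_mono fun x => ?_
            have hp : |inner ℝ (fderiv ℝ F (val y x) (val u x)) (val v x)|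
                ≤ C * (‖val u x‖ * ‖val v x‖) := by
              refine (abs_real_inner_le_norm _ _).trans ?_
              rw [← mul_assoc]
              gcongr
              exact (fderiv ℝ F (val y x)).le_of_opNorm_le (hC _) _
            refine (enorm_le_of_abs_le hp).trans (le_of_eq ?_)
            simp [enorm_mul]
        _ = C * ∫⁻ x in Ω, (‖val u x‖ₑ * ‖val v x‖ₑ) :=
            lintegral_const_mul' _ _ ENNReal.coe_ne_top
        _ ≤ C * (‖u‖ₑ * ‖v‖ₑ) := by
            gcongr
            refine (lintegral_enorm_mul_le (aesm_val u) (aesm_val v)).trans ?_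
            exact mul_le_mul' (lpNorm_two_le u) (lpNorm_two_le v)
        _ = _ := by ring)
  exact ⟨T, h1, h2⟩

/-- Hölder with χ in L^p, ∇w in L^q and ∇v in L², used with p = p₂ and q = p₁. The extra regularity
of `ū` is needed exactly to place ∇w in L^q with q > 2. -/
theorem formNuT_bilin (hd : 2 ≤ d) {ν : ℝ → ℝ} (hν : ContDiff ℝ 2 ν) {CνT : ℝ≥0}
    (hν' : ∀ t, |deriv ν t| ≤ CνT) {σ : ℝ} {p q : ℝ≥0∞} [ENNReal.HolderTriple p q 2] {C M : ℝ≥0}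
    (hC : CνT * embConst Ω p * gradEmbConst Ω σ q * M ≤ C) (y : H1v Ω 2) (w : H1v Ω d)
    (hw : MemFrac σ w) (hwM : fracNorm σ w ≤ M) :
    ∃ T : H1v Ω 2 →L[ℝ] H1v Ω d →L[ℝ] ℝ, (∀ χ v, T χ v = formNuT ν y χ w v) ∧
      ∀ χ v, |T χ v| ≤ C * ‖χ‖ * ‖v‖ := by
  obtain ⟨T, h1, h2, -⟩ := exists_continuousBilin (μ := volume.restrict Ω)
    (fun (χ : H1v Ω 2) (v : H1v Ω d) x =>
      deriv ν (val y x 0) * val χ x 0 * ∑ j, ∑ i, grad w j i x * grad v j i x)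
    (fun χ χ' v => by
      filter_upwards [val_add χ χ'] with x h
      simp [h, mul_add, add_mul])
    (fun c χ v => by
      filter_upwards [val_smul c χ] with x h
      simp [h, mul_assoc, mul_left_comm])
    (fun χ v v' => by
      filter_upwards [grad_add v v'] with x h
      simp [h, mul_add, Finset.sum_add_distrib])
    (fun c χ v => by
      filter_upwards [grad_smul c v] with x h
      simp [h, Finset.mul_sum, mul_left_comm])
    (fun χ v => (((hν.continuous_deriv (by norm_num)).comp_aestronglyMeasurable
      (aesm_val_apply y 0)).mul (aesm_val_apply χ 0)).mul
      (Finset.aestronglyMeasurable_fun_sum _ fun j _ =>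
      Finset.aestronglyMeasurable_fun_sum _ fun i _ => (aesm_grad w j i).mul (aesm_grad v j i)))
    C (fun χ v => by
      calc _ ≤ ∫⁻ x in Ω, CνT * (‖val χ x‖ₑ * ‖gradVec w x‖ₑ * ‖gradVec v x‖ₑ) := by
            refine lintegral_mono fun x => ?_
            have hp : |deriv ν (val y x 0) * val χ x 0 * ∑ j, ∑ i, grad w j i x * grad v j i x|
                ≤ CνT * (‖val χ x‖ * ‖gradVec w x‖ * ‖gradVec v x‖) := by
              rw [abs_mul, abs_mul, mul_assoc _ ‖gradVec w x‖, ← mul_assoc (CνT : ℝ)]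
              gcongr
              · exact hν' _
              · exact PiLp.norm_apply_le (val χ x) 0
              · exact abs_sum_grad_le w v x
            refine (enorm_le_of_abs_le hp).trans (le_of_eq ?_)
            simp [enorm_mul]
        _ = CνT * ∫⁻ x in Ω, ‖val χ x‖ₑ * ‖gradVec w x‖ₑ * ‖gradVec v x‖ₑ :=
            lintegral_const_mul' _ _ ENNReal.coe_ne_top
        _ ≤ CνT * ((embConst Ω p * ‖χ‖ₑ) * (gradEmbConst Ω σ q * M) * ‖v‖ₑ) := by
            gcongr
            refine (lintegral_enorm_mul_mul_le (aesm_val χ) (aesm_gradVec w) (aesm_gradVec v)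
              p q).trans ?_
            rw [← gradLpNorm_eq, ← gradLpNorm_eq]
            refine mul_le_mul' (mul_le_mul' (lpNorm_le_embConst hd p χ) ?_) (gradLpNorm_two_le v)
            exact (gradLpNorm_le_gradEmbConst q w hw).trans (by gcongr)
        _ = CνT * embConst Ω p * gradEmbConst Ω σ q * M * ‖χ‖ₑ * ‖v‖ₑ := by ring
        _ ≤ _ := by gcongr)
  exact ⟨T, h1, h2⟩

theorem formAy_bilin (D : Matrix (Fin 2) (Fin 2) ℝ) :
    ∃ T : H1v Ω 2 →L[ℝ] H1v Ω 2 →L[ℝ] ℝ, (∀ u v, T u v = formAy D u v) ∧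
      ∀ u v : H1v Ω 2, Integrable (fun x => ∑ i, ∑ k, ∑ l, D k l * grad u l i x * grad v k i x)
        (volume.restrict Ω) := by
  let C : ℝ≥0 := d * ∑ k, ∑ l, ‖D k l‖₊
  have hg : ∀ (u : H1v Ω 2) l i x, |grad u l i x| ≤ ‖gradVec u x‖ := fun u l i x =>
    PiLp.norm_apply_le (gradVec u x) (l, i)
  obtain ⟨T, h1, -, h3⟩ := exists_continuousBilin (μ := volume.restrict Ω)
    (fun (u v : H1v Ω 2) x => ∑ i, ∑ k, ∑ l, D k l * grad u l i x * grad v k i x)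
    (fun w w' v => by
      filter_upwards [grad_add w w'] with x h
      simp only [h, add_mul, mul_add, Finset.sum_add_distrib, Pi.add_apply])
    (fun c w v => by
      filter_upwards [grad_smul c w] with x h
      simp only [h, Finset.mul_sum, mul_assoc, mul_left_comm, Pi.smul_apply, smul_eq_mul])
    (fun w v v' => by
      filter_upwards [grad_add v v'] with x h
      simp only [h, mul_add, Finset.sum_add_distrib, Pi.add_apply])
    (fun c w v => by
      filter_upwards [grad_smul c v] with x h
      simp only [h, Finset.mul_sum, mul_left_comm, Pi.smul_apply, smul_eq_mul])
    (fun u v => Finset.aestronglyMeasurable_fun_sum _ fun i _ =>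
      Finset.aestronglyMeasurable_fun_sum _ fun k _ =>
      Finset.aestronglyMeasurable_fun_sum _ fun l _ =>
        ((aesm_grad u l i).const_mul _).mul (aesm_grad v k i))
    C (fun u v => by
      calc _ ≤ ∫⁻ x in Ω, C * (‖gradVec u x‖ₑ * ‖gradVec v x‖ₑ) := by
            refine lintegral_mono fun x => ?_
            have hp : |∑ i, ∑ k, ∑ l, D k l * grad u l i x * grad v k i x|
                ≤ C * (‖gradVec u x‖ * ‖gradVec v x‖) := by
              calc _ ≤ ∑ i : Fin d, ∑ k, ∑ l, |D k l| * ‖gradVec u x‖ * ‖gradVec v x‖ := by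
                    refine (Finset.abs_sum_le_sum_abs _ _).trans (Finset.sum_le_sum fun i _ =>
                      (Finset.abs_sum_le_sum_abs _ _).trans (Finset.sum_le_sum fun k _ =>
                      (Finset.abs_sum_le_sum_abs _ _).trans (Finset.sum_le_sum fun l _ => ?_)))
                    rw [abs_mul, abs_mul]
                    gcongr
                    · exact hg u l i x
                    · exact hg v k i x
                _ = _ := by
                    simp only [← Finset.sum_mul, C]
                    simp
                    ring
            refine (enorm_le_of_abs_le hp).trans (le_of_eq ?_)
            simp only [enorm_mul, enorm_norm]
            simp
        _ = C * ∫⁻ x in Ω, (‖gradVec u x‖ₑ * ‖gradVec v x‖ₑ) :=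
            lintegral_const_mul' _ _ ENNReal.coe_ne_top
        _ ≤ C * (‖u‖ₑ * ‖v‖ₑ) := by
            gcongr
            refine (lintegral_enorm_mul_le (aesm_gradVec u) (aesm_gradVec v)).trans ?_
            rw [← gradLpNorm_eq, ← gradLpNorm_eq]
            exact mul_le_mul' (gradLpNorm_two_le u) (gradLpNorm_two_le v)
        _ = _ := by ring)
  exact ⟨T, h1, h3⟩

/-! ### Test functions -/

theorem IsTest.zero : IsTest Ω 0 :=
  ⟨contDiff_const, HasCompactSupport.zero, by simp [tsupport]⟩

theorem IsTest.add {φ ψ : Pt d → ℝ} (hφ : IsTest Ω φ) (hψ : IsTest Ω ψ) : IsTest Ω (φ + ψ) :=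
  ⟨hφ.1.add hψ.1, hφ.2.1.add hψ.2.1, (tsupport_add φ ψ).trans (union_subset hφ.2.2 hψ.2.2)⟩

theorem IsTest.mul_left {f φ : Pt d → ℝ} (hf : ContDiff ℝ ∞ f) (hφ : IsTest Ω φ) :
    IsTest Ω (f * φ) :=
  ⟨hf.mul hφ.1, hφ.2.1.mul_left, (tsupport_mul_subset_right).trans hφ.2.2⟩

theorem IsTest.eq_zero {φ : Pt d → ℝ} (hφ : IsTest Ω φ) {x : Pt d} (hx : x ∉ Ω) : φ x = 0 :=
  image_eq_zero_of_notMem_tsupport fun h => hx (hφ.2.2 h)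

theorem IsTest.pderiv_eq_zero {φ : Pt d → ℝ} (hφ : IsTest Ω φ) (i : Fin d) {x : Pt d}
    (hx : x ∉ Ω) : pderiv i φ x = 0 := by
  have : fderiv ℝ φ x = 0 := image_eq_zero_of_notMem_tsupport fun h =>
    hx (hφ.2.2 (tsupport_fderiv_subset ℝ h))
  simp [pderiv, this]

theorem continuous_pderiv {f : Pt d → ℝ} (hf : ContDiff ℝ ∞ f) (i : Fin d) :
    Continuous (pderiv i f) :=
  (hf.continuous_fderiv (by simp)).clm_apply continuous_const

theorem IsTest.integral_mul_pderiv {f φ : Pt d → ℝ} (hf : ContDiff ℝ ∞ f) (hφ : IsTest Ω φ)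
    (i : Fin d) : ∫ x in Ω, f x * pderiv i φ x = - ∫ x in Ω, pderiv i f x * φ x := by
  rw [setIntegral_eq_integral_of_forall_compl_eq_zero
      (fun x hx => by rw [hφ.pderiv_eq_zero i hx, mul_zero]),
    setIntegral_eq_integral_of_forall_compl_eq_zero
      (fun x hx => by rw [hφ.eq_zero hx, mul_zero])]
  have hφ' : HasCompactSupport (pderiv i φ) := hφ.2.1.fderiv_apply ℝ _
  refine integral_mul_fderiv_eq_neg_fderiv_mul_of_integrable ?_ ?_ ?_
    (fun x _ => (hf.differentiable (by simp)) x) (fun x _ => (hφ.1.differentiable (by simp)) x)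
  · exact ((continuous_pderiv hf i).mul hφ.1.continuous).integrable_of_hasCompactSupport
      hφ.2.1.mul_left
  · exact (hf.continuous.mul (continuous_pderiv hφ.1 i)).integrable_of_hasCompactSupport
      hφ'.mul_left
  · exact (hf.continuous.mul hφ.1.continuous).integrable_of_hasCompactSupport hφ.2.1.mul_left

/-- A test function as an element of `H¹(Ω)`. -/
noncomputable def IsTest.toH1 {φ : Pt d → ℝ} (hφ : IsTest Ω φ) : H1 Ω :=
  ⟨WithLp.toLp 2 fun k => k.elim (hφ.memLp.toLp φ) fun i => (hφ.memLp_pderiv i).toLp (pderiv i φ),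
    by
      intro ψ hψ i
      have h1 : ∫ x in Ω, hφ.memLp.toLp φ x * pderiv i ψ x = ∫ x in Ω, φ x * pderiv i ψ x := by
        refine integral_congr_ae ?_
        filter_upwards [hφ.memLp.coeFn_toLp] with x hx
        rw [hx]
      have h2 : ∫ x in Ω, (hφ.memLp_pderiv i).toLp (pderiv i φ) x * ψ x
          = ∫ x in Ω, pderiv i φ x * ψ x := by
        refine integral_congr_ae ?_
        filter_upwards [(hφ.memLp_pderiv i).coeFn_toLp] with x hx
        rw [hx]
      exact (h1.trans (hψ.integral_mul_pderiv hφ.1 i)).trans (congrArg Neg.neg h2.symm)⟩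

theorem IsTest.toH1_ae {φ : Pt d → ℝ} (hφ : IsTest Ω φ) :
    ((hφ.toH1 : Jet Ω) none : Pt d → ℝ) =ᵐ[volume.restrict Ω] φ :=
  hφ.memLp.coeFn_toLp

theorem IsTest.toH1_mem {φ : Pt d → ℝ} (hφ : IsTest Ω φ) : hφ.toH1 ∈ H10 Ω :=
  Submodule.le_topologicalClosure _ (Submodule.subset_span ⟨φ, hφ, hφ.toH1_ae⟩)

/-- A smooth bump equal to 1 at a point of the open set: if it vanished a.e. on `Ω`, continuity
would make it vanish there. It keeps the best constants from being trivially 0 or ∞. -/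
theorem exists_ne_zero_mem_H10 (hΩ : IsOpen Ω) (hne : Ω.Nonempty) :
    ∃ u ∈ H10 Ω, (u : Jet Ω) none ≠ 0 := by
  obtain ⟨x, hx⟩ := hne
  obtain ⟨φ, h1, h2, h3, -, h5⟩ := exists_contDiff_tsupport_subset (n := ⊤) (hΩ.mem_nhds hx)
  have hφ : IsTest Ω φ := ⟨h3, h2, h1⟩
  refine ⟨hφ.toH1, hφ.toH1_mem, fun h0 => ?_⟩
  have h6 := hφ.toH1_ae
  rw [h0] at h6
  have h7 : φ =ᵐ[volume.restrict Ω] fun _ => 0 := h6.symm.trans (Lp.coeFn_zero ℝ 2 _)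
  have h8 := Measure.eqOn_of_ae_eq h7 h3.continuous.continuousOn continuousOn_const
    (by rw [hΩ.interior_eq]; exact subset_closure) hx
  rw [h5] at h8
  exact one_ne_zero h8

/-! ### Completeness -/

theorem integral_mul_eq_inner {μ : Measure (Pt d)} {g : Pt d → ℝ} (hg : MemLp g 2 μ)
    (f : Lp ℝ 2 μ) : ∫ x, f x * g x ∂μ = inner ℝ (hg.toLp g) f := by
  rw [L2.inner_def]
  refine integral_congr_ae ?_
  filter_upwards [hg.coeFn_toLp] with x hx
  simp [hx]

theorem continuous_integral_mul {μ : Measure (Pt d)} {g : Pt d → ℝ} (hg : MemLp g 2 μ) :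
    Continuous fun f : Lp ℝ 2 μ => ∫ x, f x * g x ∂μ := by
  simp only [integral_mul_eq_inner hg]
  exact continuous_const.inner continuous_id

/-- Each defining identity equates L² inner products with fixed functions, which are continuous in
the jet. -/
theorem isClosed_H1 (Ω : Set (Pt d)) : IsClosed (H1 Ω : Set (Jet Ω)) := by
  have : (H1 Ω : Set (Jet Ω)) = ⋂ (φ) (_ : IsTest Ω φ) (i : Fin d), {w : Jet Ω |
      ∫ x in Ω, w none x * pderiv i φ x = - ∫ x in Ω, w (some i) x * φ x} := by
    ext w; simp only [mem_iInter]; rfl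
  rw [this]
  refine isClosed_iInter fun φ => isClosed_iInter fun hφ => isClosed_iInter fun i => ?_
  exact isClosed_eq
    ((continuous_integral_mul (hφ.memLp_pderiv i)).comp (PiLp.continuous_apply 2 _ none))
    ((continuous_integral_mul hφ.memLp).comp (PiLp.continuous_apply 2 _ (some i))).neg

instance completeSpace_H1 : CompleteSpace (H1 Ω) := (isClosed_H1 Ω).completeSpace_coe

theorem isClosed_H10v (Ω : Set (Pt d)) (m : ℕ) : IsClosed (H10v Ω m : Set (H1v Ω m)) := by
  have : (H10v Ω m : Set (H1v Ω m)) = ⋂ j : Fin m, {w : H1v Ω m | w j ∈ H10 Ω} := by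
    ext w; simp only [mem_iInter]; rfl
  rw [this]
  exact isClosed_iInter fun j => (Submodule.isClosed_topologicalClosure _).preimage
    (PiLp.continuous_apply 2 _ j)

instance completeSpace_H10v : CompleteSpace (H10v Ω m) := (isClosed_H10v Ω m).completeSpace_coe

theorem isClosed_X (Ω : Set (Pt d)) : IsClosed (X Ω : Set (H1v Ω d)) := by
  have : (X Ω : Set (H1v Ω d)) = (H10v Ω d : Set (H1v Ω d)) ∩ {v | divergence v = 0} := rfl
  rw [this]
  refine (isClosed_H10v Ω d).inter (isClosed_eq ?_ continuous_const)
  exact continuous_finsetSum _ fun i _ => (PiLp.continuous_apply 2 _ (some i)).comp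
    (continuous_subtype_val.comp (PiLp.continuous_apply 2 _ i))

instance completeSpace_X : CompleteSpace (X Ω) := (isClosed_X Ω).completeSpace_coe

/-! ### Density of test functions -/

/-- Functions agreeing a.e. with a test function already form a subspace, so the span adds nothing
and a closed property need only be checked on them. -/
theorem H10_induction {P : H1 Ω → Prop} (hP : IsClosed {u : H1 Ω | P u})
    (h : ∀ (u : H1 Ω) φ, IsTest Ω φ → ((u : Jet Ω) none : Pt d → ℝ) =ᵐ[volume.restrict Ω] φ → P u)
    {u : H1 Ω} (hu : u ∈ H10 Ω) : P u := by
  refine closure_minimal (t := {u : H1 Ω | P u}) (fun v hv => ?_) hP hu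
  obtain ⟨φ, hφ, hvφ⟩ : ∃ φ, IsTest Ω φ ∧
      ((v : Jet Ω) none : Pt d → ℝ) =ᵐ[volume.restrict Ω] φ := by
    refine Submodule.span_induction (p := fun (w : H1 Ω) _ => ∃ φ, IsTest Ω φ ∧
      ((w : Jet Ω) none : Pt d → ℝ) =ᵐ[volume.restrict Ω] φ) (fun w hw => hw)
      ⟨0, IsTest.zero, Lp.coeFn_zero ℝ 2 _⟩ ?_ ?_ hv
    · rintro u v - - ⟨φ, hφ, h1⟩ ⟨ψ, hψ, h2⟩
      exact ⟨φ + ψ, hφ.add hψ, (Lp.coeFn_add _ _).trans (h1.add h2)⟩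
    · rintro c u - ⟨φ, hφ, h1⟩
      refine ⟨(fun _ => c) * φ, IsTest.mul_left contDiff_const hφ,
        (Lp.coeFn_smul c ((u : Jet Ω) none)).trans ?_⟩
      filter_upwards [h1] with x hx
      simp [hx]
  exact h v φ hφ hvφ

/-- The generators of `H10` prescribe the value only. The derivative components are then forced by
uniqueness of weak derivatives, through the fundamental lemma of the calculus of variations. -/
theorem weakDeriv_ae_eq (hΩ : IsOpen Ω) {u : H1 Ω} {φ : Pt d → ℝ} (hφ : IsTest Ω φ)
    (h : ((u : Jet Ω) none : Pt d → ℝ) =ᵐ[volume.restrict Ω] φ) (i : Fin d) :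
    ((u : Jet Ω) (some i) : Pt d → ℝ) =ᵐ[volume.restrict Ω] pderiv i φ := by
  have hm : MemLp (fun x => (u : Jet Ω) (some i) x - pderiv i φ x) 2 (volume.restrict Ω) :=
    (Lp.memLp _).sub (hφ.memLp_pderiv i)
  have hloc : LocallyIntegrableOn (fun x => (u : Jet Ω) (some i) x - pderiv i φ x) Ω volume :=
    locallyIntegrableOn_of_locallyIntegrable_restrict (hm.locallyIntegrable (by norm_num))
  have key := hΩ.ae_eq_zero_of_integral_contDiff_smul_eq_zero hloc (fun ψ h1 h2 h3 => by
    have hψ : IsTest Ω ψ := ⟨h1, h2, h3⟩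
    rw [← setIntegral_eq_integral_of_forall_compl_eq_zero (s := Ω)
      (fun x hx => by rw [hψ.eq_zero hx, zero_smul])]
    have e1 := u.2 ψ hψ i
    have e2 := hψ.integral_mul_pderiv hφ.1 i
    have e3 : ∫ x in Ω, (u : Jet Ω) none x * pderiv i ψ x = ∫ x in Ω, φ x * pderiv i ψ x := by
      refine integral_congr_ae ?_
      filter_upwards [h] with x hx
      rw [hx]
    have e4 : ∫ x in Ω, ψ x • ((u : Jet Ω) (some i) x - pderiv i φ x)
        = (∫ x in Ω, (u : Jet Ω) (some i) x * ψ x) - ∫ x in Ω, pderiv i φ x * ψ x := by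
      refine Eq.trans ?_ (integral_sub ((Lp.memLp _).integrable_mul hψ.memLp)
        ((hφ.memLp_pderiv i).integrable_mul hψ.memLp))
      refine integral_congr_ae (Filter.Eventually.of_forall fun x => ?_)
      simp only [smul_eq_mul]; ring
    rw [e4]
    linarith)
  filter_upwards [ae_restrict_of_ae key, ae_restrict_mem hΩ.measurableSet] with x hx hxΩ
  exact sub_eq_zero.1 (hx hxΩ)

/-! ### Poincaré's inequality -/

theorem norm_L2_sq (f : L2 Ω) : ‖f‖ ^ 2 = ∫ x in Ω, f x ^ 2 := by
  rw [← real_inner_self_eq_norm_sq, L2.inner_def]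
  simp [pow_two]

/-- Since ∂ᵢxᵢ = 1, integration by parts gives ∫φ² = −∫ 2xᵢ φ ∂ᵢφ for test functions. As |xᵢ| ≤ R,
Young's inequality bounds this by ½∫φ² + 2R²∫(∂ᵢφ)², and the first term is absorbed. -/
theorem poincare (hΩ : IsOpen Ω) {R : ℝ} (hR : Ω ⊆ Metric.ball 0 R) (i : Fin d)
    {u : H1 Ω} (hu : u ∈ H10 Ω) :
    ‖(u : Jet Ω) none‖ ^ 2 ≤ 4 * R ^ 2 * ‖(u : Jet Ω) (some i)‖ ^ 2 := by
  have hc : ∀ k, Continuous fun u : H1 Ω => ‖(u : Jet Ω) k‖ := fun k =>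
    ((PiLp.continuous_apply 2 _ k).comp continuous_subtype_val).norm
  have hcl : IsClosed {u : H1 Ω |
      ‖(u : Jet Ω) none‖ ^ 2 ≤ 4 * R ^ 2 * ‖(u : Jet Ω) (some i)‖ ^ 2} :=
    isClosed_le ((hc none).pow 2) (continuous_const.mul ((hc (some i)).pow 2))
  refine H10_induction hcl (fun u φ hφ h => ?_) hu
  have h' := weakDeriv_ae_eq hΩ hφ h i
  rw [norm_L2_sq, norm_L2_sq]
  have e1 : ∫ x in Ω, (u : Jet Ω) none x ^ 2 = ∫ x in Ω, φ x ^ 2 :=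
    integral_congr_ae (by filter_upwards [h] with x hx; rw [hx])
  have e2 : ∫ x in Ω, (u : Jet Ω) (some i) x ^ 2 = ∫ x in Ω, pderiv i φ x ^ 2 :=
    integral_congr_ae (by filter_upwards [h'] with x hx; rw [hx])
  rw [e1, e2]
  have hcoord : ContDiff ℝ ∞ fun x : Pt d => x i := (EuclideanSpace.proj (𝕜 := ℝ) i).contDiff
  have hcd : ∀ x : Pt d, pderiv i (fun x : Pt d => x i) x = 1 := fun x => by
    have : fderiv ℝ (fun x : Pt d => x i) x = EuclideanSpace.proj (𝕜 := ℝ) i :=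
      (EuclideanSpace.proj (𝕜 := ℝ) i).hasFDerivAt.fderiv
    simp [pderiv, this]
  have hsq : ∀ x, pderiv i (φ * φ) x = 2 * φ x * pderiv i φ x := fun x => by
    have hdx := (hφ.1.differentiable (by simp)) x
    simp only [pderiv, fderiv_mul hdx hdx]
    simp; ring
  have e3 := (IsTest.mul_left hφ.1 hφ).integral_mul_pderiv hcoord i
  simp only [hcd, hsq, one_mul] at e3
  have i1 : Integrable (fun x => φ x ^ 2) (volume.restrict Ω) := hφ.memLp.integrable_sq
  have i2 : Integrable (fun x => pderiv i φ x ^ 2) (volume.restrict Ω) :=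
    (hφ.memLp_pderiv i).integrable_sq
  have e4 : ∫ x in Ω, φ x ^ 2
      ≤ ∫ x in Ω, (φ x ^ 2 / 2 + 2 * R ^ 2 * pderiv i φ x ^ 2) := by
    have : ∫ x in Ω, φ x ^ 2 = ∫ x in Ω, -(x i * (2 * φ x * pderiv i φ x)) := by
      rw [integral_neg, e3, neg_neg]
      congr 1; ext x; simp [pow_two]
    rw [this]
    refine setIntegral_mono_on ?_ ((i1.div_const 2).add (i2.const_mul _)) hΩ.measurableSet ?_
    · have : Continuous fun x : Pt d => -(x i * (2 * φ x * pderiv i φ x)) :=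
        (hcoord.continuous.mul ((continuous_const.mul hφ.1.continuous).mul
          (continuous_pderiv hφ.1 i))).neg
      refine (this.integrable_of_hasCompactSupport ?_).integrableOn
      refine hφ.2.1.mono ?_
      intro x hx hx0
      exact hx (by simp [hx0])
    · intro x hx
      have hxR : |x i| ≤ R :=
        (PiLp.norm_apply_le x i).trans (mem_ball_zero_iff.1 (hR hx)).le
      have hx2 : (x i) ^ 2 ≤ R ^ 2 := sq_le_sq' (abs_le.1 hxR).1 (abs_le.1 hxR).2
      nlinarith [sq_nonneg (φ x + 2 * x i * pderiv i φ x),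
        mul_le_mul_of_nonneg_right hx2 (sq_nonneg (pderiv i φ x))]
  rw [integral_add (i1.div_const 2) (i2.const_mul _), integral_div, integral_const_mul] at e4
  linarith

/-! ### Skew-symmetry of the convective form -/

/-- For a scalar test function, (w·∇φ)φ = ½ w·∇(φ²), whose integral is −½∫(div w)φ² = 0. Continuity
of the form extends this to H¹₀, and a field is treated component by component. Only v needs zero
boundary values. -/
theorem formC_self_eq_zero (hΩ : IsOpen Ω) (hd : 1 ≤ d)
    (hfin : embConst Ω 6 * embConst Ω 3 ≠ ⊤)
    {w : H1v Ω d} (hw : divergence w = 0) {v : H1v Ω m} (hv : v ∈ H10v Ω m) :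
    formC w v v = 0 := by
  let ι : H1 Ω → H1v Ω 1 := fun u => WithLp.toLp 2 fun _ => u
  have hι : Continuous ι := (PiLp.continuous_toLp 2 _).comp (continuous_pi fun _ => continuous_id)
  obtain ⟨T, hT, hTi⟩ := formC_bilin_right (Ω := Ω) (m := 1) hd
    (ENNReal.coe_toNNReal hfin).ge w
  have hsc : ∀ u ∈ H10 Ω, formC w (ι u) (ι u) = 0 := by
    intro u hu
    refine H10_induction (P := fun u => formC w (ι u) (ι u) = 0)
      (isClosed_eq ?_ continuous_const) (fun u φ hφ h => ?_) hu
    · simp only [← hT]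
      exact (T.continuous.comp hι).clm_apply hι
    have hsq : ∀ i x, pderiv i (φ * φ) x = 2 * φ x * pderiv i φ x := fun i x => by
      have hdx := (hφ.1.differentiable (by simp)) x
      simp only [pderiv, fderiv_mul hdx hdx]
      simp; ring
    have hφφ := IsTest.mul_left hφ.1 hφ
    have hgr : ∀ᵐ x ∂volume.restrict Ω, ∀ i, (u : Jet Ω) (some i) x = pderiv i φ x :=
      ae_all_iff.2 fun i => weakDeriv_ae_eq hΩ hφ h i
    have e1 : formC w (ι u) (ι u) =
        ∫ x in Ω, ∑ i, (1 / 2 : ℝ) * ((w i : Jet Ω) none x * pderiv i (φ * φ) x) := by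
      refine integral_congr_ae ?_
      filter_upwards [h, hgr] with x h1 h2
      simp only [Fin.sum_univ_one, Finset.sum_mul, hsq, ι, val, grad, h1, h2]
      refine Finset.sum_congr rfl fun i _ => ?_
      ring
    have hint : ∀ i, Integrable (fun x => (1 / 2 : ℝ) *
        ((w i : Jet Ω) none x * pderiv i (φ * φ) x)) (volume.restrict Ω) := fun i =>
      ((Lp.memLp _).integrable_mul (hφφ.memLp_pderiv i)).const_mul _
    rw [e1, integral_finsetSum _ fun i _ => hint i]
    -- φ² is itself a test function, so the weak derivatives of w may be tested against it.
    simp only [integral_const_mul, (w _).2 _ hφφ]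
    rw [← Finset.mul_sum, Finset.sum_neg_distrib]
    simp only [integral_mul_eq_inner hφφ.memLp]
    rw [← inner_sum]
    have : ∑ i, ((w i : Jet Ω) (some i)) = 0 := hw
    rw [this]
    simp
  have hsum : formC w v v = ∑ j, formC w (ι (v j)) (ι (v j)) := by
    refine Eq.trans ?_ (integral_finsetSum _ fun j _ => hTi _ _)
    refine integral_congr_ae (Filter.Eventually.of_forall fun x => ?_)
    refine Finset.sum_congr rfl fun j _ => ?_
    simp only [Fin.sum_univ_one]
    rfl
  rw [hsum]
  exact Finset.sum_eq_zero fun j _ => hsc _ (hv j)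

/-! ### The permeability -/

/-- The column w = A⁻¹eⱼ satisfies κ|w|² ≤ w·Aw = wⱼ. This first gives wⱼ ≤ 1/κ, and then κwᵢ² ≤ 1/κ
for every i. -/
theorem abs_inv_entry_le {A : Matrix (Fin d) (Fin d) ℝ} {κ : ℝ} (hκ : 0 < κ)
    (h : ∀ v : Fin d → ℝ, κ * (v ⬝ᵥ v) ≤ v ⬝ᵥ A.mulVec v) (i j : Fin d) : |A⁻¹ i j| ≤ 1 / κ := by
  have hdet : IsUnit A.det := by
    rw [isUnit_iff_ne_zero]
    intro h0
    obtain ⟨v, hv, hv0⟩ := Matrix.exists_mulVec_eq_zero_iff.2 h0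
    have := h v
    rw [hv0, dotProduct_zero] at this
    have h1 : 0 ≤ v ⬝ᵥ v := Finset.sum_nonneg fun i _ => mul_self_nonneg _
    exact hv (dotProduct_self_eq_zero.1 (le_antisymm (by nlinarith) h1))
  let w := A⁻¹.mulVec (Pi.single j 1)
  have hw : A.mulVec w = Pi.single j 1 := by
    rw [Matrix.mulVec_mulVec, Matrix.mul_nonsing_inv _ hdet, Matrix.one_mulVec]
  have hwi : ∀ i, w i = A⁻¹ i j := fun i => by simp [w]
  have hle : ∀ i, w i ^ 2 ≤ w ⬝ᵥ w := fun i => by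
    rw [pow_two]
    exact Finset.single_le_sum (f := fun i => w i * w i) (fun i _ => mul_self_nonneg _)
      (Finset.mem_univ i)
  have h1 := h w
  rw [hw, dotProduct_single, mul_one] at h1
  have hj : w j ≤ 1 / κ := by
    rw [le_div_iff₀ hκ]
    by_contra! hcon
    have h2 : 0 < w j := by
      by_contra! h3
      nlinarith
    nlinarith [mul_le_mul_of_nonneg_left (hle j) hκ.le]
  rw [← hwi]
  refine abs_le_of_sq_le_sq ?_ (by positivity)
  have h4 : κ * w i ^ 2 ≤ 1 / κ := (mul_le_mul_of_nonneg_left (hle i) hκ.le).trans (h1.trans hj)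
  rw [div_pow, one_pow, le_div_iff₀ (by positivity)]
  rw [le_div_iff₀ hκ] at h4
  linarith

/-- By Cramer's rule the entry is det⁻¹ times a cofactor; both conventions for inverting a zero
determinant return 0, so the formula holds everywhere. -/
theorem aesm_inv_entry {μ : Measure (Pt d)} {K : Pt d → Matrix (Fin d) (Fin d) ℝ}
    (hK : ∀ i j, AEMeasurable (fun x => K x i j) μ) (i j : Fin d) :
    AEStronglyMeasurable (fun x => (K x)⁻¹ i j) μ := by
  have hm : AEMeasurable (fun x (a b : Fin d) => K x a b) μ :=
    aemeasurable_pi_lambda _ fun a => aemeasurable_pi_lambda _ fun b => hK a b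
  have h1 : Continuous fun B : Fin d → Fin d → ℝ => (Matrix.of B).det :=
    Continuous.matrix_det (A := fun B : Fin d → Fin d → ℝ => Matrix.of B) continuous_id
  have h2 : Continuous fun B : Fin d → Fin d → ℝ => (Matrix.of B).adjugate i j :=
    (Continuous.matrix_adjugate (A := fun B : Fin d → Fin d → ℝ => Matrix.of B)
      continuous_id).matrix_elem i j
  have h3 := ((h1.measurable.inv).mul h2.measurable).comp_aemeasurable hm
  refine AEMeasurable.aestronglyMeasurable (h3.congr (Filter.Eventually.of_forall fun x => ?_))
  simp only [Matrix.inv_def, Ring.inverse_eq_inv', Matrix.smul_apply, smul_eq_mul]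
  rfl

theorem formA_bilin (hΩ : IsOpen Ω) {K : Pt d → Matrix (Fin d) (Fin d) ℝ}
    (hKm : ∀ i j, AEMeasurable (fun x => K x i j) (volume.restrict Ω))
    (hKpos : ∃ κ > 0, ∀ x ∈ Ω, ∀ v : Fin d → ℝ, κ * (v ⬝ᵥ v) ≤ v ⬝ᵥ (K x).mulVec v)
    {ν : ℝ → ℝ} {ν₁ ν₂ : ℝ} (hν₁ : 0 < ν₁) (hνb : ∀ t, ν₁ ≤ ν t ∧ ν t ≤ ν₂) (hν : Continuous ν)
    (y : H1v Ω 2) : ∃ T : H1v Ω d →L[ℝ] H1v Ω d →L[ℝ] ℝ, ∀ u v, T u v = formA K ν y u v := by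
  obtain ⟨κ, hκ, hpos⟩ := hKpos
  obtain ⟨T₁, h₁⟩ := weighted_val_bilin (Ω := Ω) (aesm_inv_entry hKm) (C := ⟨1 / κ, by positivity⟩)
    (by
      filter_upwards [ae_restrict_mem hΩ.measurableSet] with x hx i j
      exact abs_inv_entry_le hκ (hpos x hx) i j)
  have hν₂ : 0 ≤ ν₂ := hν₁.le.trans ((hνb 0).1.trans (hνb 0).2)
  obtain ⟨T₂, h₂⟩ := weighted_grad_bilin (m := d)
    (hν.comp_aestronglyMeasurable (aesm_val_apply y 0)) (C := ⟨ν₂, hν₂⟩) (fun x => by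
      rw [abs_of_pos (hν₁.trans_le (hνb _).1)]
      exact (hνb _).2)
  refine ⟨T₁ + T₂, fun u v => ?_⟩
  rw [add_apply, add_apply, h₁, h₂]
  rfl

/-! ### Coercivity constants -/

theorem ofReal_mul_enorm_sq {V : Type*} [SeminormedAddCommGroup V] {a : ℝ} (ha : 0 ≤ a) (v : V) :
    ENNReal.ofReal a * ‖v‖ₑ ^ 2 = ENNReal.ofReal (a * ‖v‖ ^ 2) := by
  rw [← ofReal_norm, ← ENNReal.ofReal_pow (norm_nonneg _), ← ENNReal.ofReal_mul ha]

/-- `ENNReal.ofReal` truncates negative values, but for v ≠ 0 the left side is positive, so no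
truncation occurs. -/
theorem le_of_ofReal_mul_enorm_sq_le {V : Type*} [NormedAddCommGroup V] {q : V → ℝ} (hq : q 0 = 0)
    {a : ℝ} (ha : 0 < a) {v : V} (h : ENNReal.ofReal a * ‖v‖ₑ ^ 2 ≤ ENNReal.ofReal (q v)) :
    a * ‖v‖ ^ 2 ≤ q v := by
  rw [ofReal_mul_enorm_sq ha.le, ENNReal.ofReal_le_ofReal_iff'] at h
  rcases h with h | h
  · exact h
  · have : v = 0 := by
      by_contra h0
      have := norm_pos_iff.2 h0
      have : 0 < a * ‖v‖ ^ 2 := by positivity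
      linarith
    rw [this, hq]; simp

/-- Ellipticity of `D`, applied to the vector (∂ᵢsₖ)ₖ for each i, controls the full gradient;
Poincaré in the first coordinate direction adds the values. -/
theorem formAy_coercive (hΩ : IsOpen Ω) (hΩb : Bornology.IsBounded Ω) (hd : 1 ≤ d)
    {D : Matrix (Fin 2) (Fin 2) ℝ}
    (hD : ∃ α₂ > 0, ∀ s : Fin 2 → ℝ, α₂ * (s ⬝ᵥ s) ≤ s ⬝ᵥ D.mulVec s) :
    ∃ α > 0, ∀ s : H10v Ω 2, α * ‖s‖ ^ 2 ≤ formAy D (s : H1v Ω 2) s := by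
  obtain ⟨R, -, hR⟩ := hΩb.subset_ball_lt 0 0
  obtain ⟨α₂, hα₂, hD⟩ := hD
  obtain ⟨T, -, hT⟩ := formAy_bilin (Ω := Ω) D
  refine ⟨α₂ / (4 * R ^ 2 + 1), by positivity, fun s => ?_⟩
  let N := ∑ k : Fin 2, ∑ i, ‖((s : H1v Ω 2) k : Jet Ω) (some i)‖ ^ 2
  have h1 : ‖s‖ ^ 2 ≤ (4 * R ^ 2 + 1) * N := by
    rw [Submodule.coe_norm, norm_sq_H1v, Finset.mul_sum]
    refine Finset.sum_le_sum fun k _ => ?_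
    have h2 := poincare hΩ hR ⟨0, hd⟩ (s.2 k)
    have h3 : ‖((s : H1v Ω 2) k : Jet Ω) (some ⟨0, hd⟩)‖ ^ 2
        ≤ ∑ i, ‖((s : H1v Ω 2) k : Jet Ω) (some i)‖ ^ 2 :=
      Finset.single_le_sum (f := fun i => ‖((s : H1v Ω 2) k : Jet Ω) (some i)‖ ^ 2)
        (fun i _ => by positivity) (Finset.mem_univ _)
    have h4 := mul_le_mul_of_nonneg_left h3 (show 0 ≤ 4 * R ^ 2 by positivity)
    linarith
  have hi : ∀ k i, Integrable (fun x => grad (s : H1v Ω 2) k i x ^ 2) (volume.restrict Ω) :=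
    fun k i => (Lp.memLp _).integrable_sq
  have h2 : α₂ * N ≤ formAy D (s : H1v Ω 2) s := by
    have e : α₂ * N = ∫ x in Ω, α₂ * ∑ i, ∑ k, grad (s : H1v Ω 2) k i x ^ 2 := by
      rw [integral_const_mul, integral_finsetSum _
        fun i _ => integrable_finsetSum _ fun k _ => hi k i]
      simp only [integral_finsetSum _ fun k _ => hi k _, N, norm_L2_sq]
      rw [Finset.sum_comm]
      rfl
    rw [e]
    refine integral_mono ((integrable_finsetSum _ fun i _ =>
      integrable_finsetSum _ fun k _ => hi k i).const_mul _) (hT s s) fun x => ?_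
    simp only
    rw [Finset.mul_sum]
    refine Finset.sum_le_sum fun i _ => ?_
    have := hD fun k => grad (s : H1v Ω 2) k i x
    simp only [dotProduct, Matrix.mulVec, Finset.mul_sum] at this
    refine le_trans (le_of_eq ?_) (this.trans (le_of_eq ?_))
    · simp only [Finset.mul_sum, pow_two]
    · refine Finset.sum_congr rfl fun k _ => Finset.sum_congr rfl fun l _ => ?_
      ring
  rw [div_mul_eq_mul_div, div_le_iff₀ (by positivity)]
  have := mul_le_mul_of_nonneg_left h1 hα₂.le
  have h3 := mul_le_mul_of_nonneg_right h2 (show 0 ≤ 4 * R ^ 2 + 1 by positivity)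
  linarith

theorem coercAy_ne_zero (hΩ : IsOpen Ω) (hΩb : Bornology.IsBounded Ω) (hd : 1 ≤ d)
    {D : Matrix (Fin 2) (Fin 2) ℝ}
    (hD : ∃ α₂ > 0, ∀ s : Fin 2 → ℝ, α₂ * (s ⬝ᵥ s) ≤ s ⬝ᵥ D.mulVec s) : coercAy Ω D ≠ 0 := by
  obtain ⟨α, hα, h⟩ := formAy_coercive hΩ hΩb hd hD
  have : ENNReal.ofReal α ≤ coercAy Ω D := le_sSup fun s => by
    rw [ofReal_mul_enorm_sq hα.le]
    exact ENNReal.ofReal_le_ofReal (h s)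
  exact ((ENNReal.ofReal_pos.2 hα).trans_le this).ne'

theorem coercAy_mul_le (D : Matrix (Fin 2) (Fin 2) ℝ) (s : H10v Ω 2) :
    coercAy Ω D * ‖s‖ₑ ^ 2 ≤ ENNReal.ofReal (formAy D (s : H1v Ω 2) s) := by
  rcases eq_or_ne (‖s‖ₑ ^ 2) 0 with h0 | h0
  · simp [h0]
  have ht : ‖s‖ₑ ^ 2 ≠ ⊤ := by finiteness
  rw [← ENNReal.le_div_iff_mul_le (Or.inl h0) (Or.inl ht)]
  exact sSup_le fun α hα => (ENNReal.le_div_iff_mul_le (Or.inl h0) (Or.inl ht)).2 (hα s)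

theorem exists_ne_zero_H10v (hΩ : IsOpen Ω) (hne : Ω.Nonempty) (hm : 0 < m) :
    ∃ s : H10v Ω m, lpNorm 2 (s : H1v Ω m) ≠ 0 := by
  obtain ⟨u, hu, hu0⟩ := exists_ne_zero_mem_H10 hΩ hne
  refine ⟨⟨WithLp.toLp 2 fun _ => u, fun _ => hu⟩, fun h => hu0 ?_⟩
  rw [lpNorm, eLpNorm_eq_zero_iff (aesm_val _) (by norm_num)] at h
  rw [Lp.eq_zero_iff_ae_eq_zero]
  filter_upwards [h] with x hx
  exact congrArg (fun z : EuclideanSpace ℝ (Fin m) => z ⟨0, hm⟩) hx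

/-- An infinite constant would make the terms divided by it disappear from the smallness condition;
a nonzero element of H¹₀ rules it out. -/
theorem coercAy_ne_top (hΩ : IsOpen Ω) (hne : Ω.Nonempty) (D : Matrix (Fin 2) (Fin 2) ℝ) :
    coercAy Ω D ≠ ⊤ := by
  obtain ⟨s, hs⟩ := exists_ne_zero_H10v (m := 2) hΩ hne two_pos
  intro h
  have := coercAy_mul_le D s
  rw [h, ENNReal.top_mul] at this
  · exact ENNReal.ofReal_ne_top (top_le_iff.1 this)
  · intro h0
    refine hs (nonpos_iff_eq_zero.1 ((lpNorm_two_le _).trans ?_))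
    exact (pow_eq_zero_iff two_ne_zero).1 h0 |>.le

/-- Rules out 0 · ∞ = 0 in the smallness condition, where a zero factor C₆C₃ would hide an infinite
one. -/
theorem embConst_ne_zero (hΩ : IsOpen Ω) (hne : Ω.Nonempty) (hd : 0 < d) {p : ℝ≥0∞} (hp : p ≠ 0) :
    embConst Ω p ≠ 0 := by
  obtain ⟨s, hs⟩ := exists_ne_zero_H10v (m := d) hΩ hne hd
  intro h
  have h1 := lpNorm_le_embConst_self p (s : H1v Ω d)
  rw [h, zero_mul, nonpos_iff_eq_zero, lpNorm, eLpNorm_eq_zero_iff (aesm_val _) hp] at h1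
  exact hs (by rw [lpNorm, eLpNorm_congr_ae h1, eLpNorm_zero])

/-- Working strictly below the supremum avoids asking whether it is finite. -/
theorem le_formA_of_lt_coercA {K : Pt d → Matrix (Fin d) (Fin d) ℝ} {ν : ℝ → ℝ} {a : ℝ}
    (ha : 0 < a) (h : ENNReal.ofReal a < coercA Ω K ν) (y : H1v Ω 2)
    (h0 : formA K ν y 0 0 = 0) (v : H10v Ω d) :
    a * ‖v‖ ^ 2 ≤ formA K ν y v v := by
  obtain ⟨α, hα, haα⟩ := lt_sSup_iff.1 h
  refine le_of_ofReal_mul_enorm_sq_le (q := fun v : H10v Ω d => formA K ν y v v) h0 ha ?_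
  exact (mul_le_mul_left haα.le _).trans (hα y v)

/-! ### The smallness condition in real numbers -/

/-- Under the smallness condition the constants are finite, and the condition holds between real
numbers. -/
theorem Smallness.exists_real (hΩ : IsOpen Ω) (hne : Ω.Nonempty) (hΩb : Bornology.IsBounded Ω)
    (hd : 0 < d) {K : Pt d → Matrix (Fin d) (Fin d) ℝ} {ν : ℝ → ℝ} {D : Matrix (Fin 2) (Fin 2) ℝ}
    (hD : ∃ α₂ > 0, ∀ s : Fin 2 → ℝ, α₂ * (s ⬝ᵥ s) ≤ s ⬝ᵥ D.mulVec s)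
    {δ : ℝ} {CνT CFy Mu My M : ℝ≥0} (hMu : 0 < Mu) (hMy : 0 < My)
    (h : Smallness Ω K ν D δ CνT CFy Mu My M) :
    ∃ C G α a : ℝ≥0, embConst Ω 6 * embConst Ω 3 = C ∧
      CνT * embConst Ω (ENNReal.ofReal (p₂ d δ))
        * gradEmbConst Ω (1 / 2 + δ) (ENNReal.ofReal (p₁ d δ)) * M = G ∧
      coercAy Ω D = α ∧ 0 < α ∧ (a : ℝ≥0∞) < coercA Ω K ν ∧
      C * (G * My / α + Mu + CFy * My / α) < a := by
  have hc0 := coercAy_ne_zero hΩ hΩb hd hD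
  have hct := coercAy_ne_top hΩ hne D
  have h60 := embConst_ne_zero hΩ hne hd (p := 6) (by norm_num)
  have h30 := embConst_ne_zero hΩ hne hd (p := 3) (by norm_num)
  obtain ⟨a, ha1, ha2⟩ := ENNReal.lt_iff_exists_nnreal_btwn.1 h
  have hMy0 : (My : ℝ≥0∞) ≠ 0 := by exact_mod_cast hMy.ne'
  have hMu0 : (Mu : ℝ≥0∞) ≠ 0 := by exact_mod_cast hMu.ne'
  have hlt := ha1.trans ENNReal.coe_lt_top
  -- Since M_u > 0, an infinite C₆C₃ makes the left side of the smallness condition infinite. The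
  -- same argument below uses M_y > 0, α̂_a < ∞ and C₆C₃ ≠ 0.
  have hCt : embConst Ω 6 * embConst Ω 3 ≠ ⊤ := by
    intro ht
    rw [ht, ENNReal.top_mul (by simp [hMu0])] at hlt
    exact lt_irrefl _ hlt
  have hGt : CνT * embConst Ω (ENNReal.ofReal (p₂ d δ))
        * gradEmbConst Ω (1 / 2 + δ) (ENNReal.ofReal (p₁ d δ)) * M ≠ ⊤ := by
    intro ht
    rw [ht, ENNReal.top_mul hMy0, ENNReal.top_div_of_ne_top hct, top_add, top_add,
      ENNReal.mul_top (mul_ne_zero h60 h30)] at hlt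
    exact lt_irrefl _ hlt
  lift embConst Ω 6 * embConst Ω 3 to ℝ≥0 using hCt with C
  lift CνT * embConst Ω (ENNReal.ofReal (p₂ d δ))
        * gradEmbConst Ω (1 / 2 + δ) (ENNReal.ofReal (p₁ d δ)) * M to ℝ≥0 using hGt with G
  lift coercAy Ω D to ℝ≥0 using hct with α
  have hα : α ≠ 0 := by exact_mod_cast hc0
  refine ⟨C, G, α, a, rfl, rfl, rfl, pos_iff_ne_zero.2 hα, ha2, ?_⟩
  have e : ∀ x y : ℝ≥0, (x : ℝ≥0∞) * y / α = (x * y / α : ℝ≥0) := fun x y => by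
    rw [ENNReal.coe_div hα, ENNReal.coe_mul]
  rw [e, e] at ha1
  exact_mod_cast ha1

theorem holderTriple_p₂_p₁ (hd : d = 2 ∨ d = 3) {δ : ℝ} (hδ : δ ∈ Set.Ioo (0 : ℝ) (1 / 2)) :
    ENNReal.HolderTriple (ENNReal.ofReal (p₂ d δ)) (ENNReal.ofReal (p₁ d δ)) 2 := by
  obtain ⟨h0, h1⟩ := hδ
  have hd0 : (2 : ℝ) ≤ d := by rcases hd with rfl | rfl <;> norm_num
  have hq1 : 0 < (d : ℝ) - 1 - 2 * δ := by linarith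
  have hq2 : 0 < 1 + 2 * δ := by linarith
  have hp2 : 0 < p₂ d δ := by unfold p₂; positivity
  have hp1 : 0 < p₁ d δ := by unfold p₁; positivity
  constructor
  rw [← ENNReal.ofReal_inv_of_pos hp2, ← ENNReal.ofReal_inv_of_pos hp1,
    ← ENNReal.ofReal_add (by positivity) (by positivity)]
  have : (p₂ d δ)⁻¹ + (p₁ d δ)⁻¹ = (2 : ℝ)⁻¹ := by
    unfold p₂ p₁
    field_simp
    ring
  rw [this, ENNReal.ofReal_inv_of_pos two_pos]
  simp

/-! ### Hilbert structure and the four forms of the linearized problem -/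

/-- Shortcut instance: the search is slow on nested products and submodules. -/
noncomputable abbrev normedAddCommGroup_H1v : NormedAddCommGroup (H1v Ω m) := inferInstance

attribute [local instance] normedAddCommGroup_H1v

/-- Shortcut instance. -/
noncomputable abbrev normedSpace_H1v : NormedSpace ℝ (H1v Ω m) := inferInstance

attribute [local instance] normedSpace_H1v

theorem parallelogram_H1v (x y : H1v Ω m) :
    ‖x + y‖ * ‖x + y‖ + ‖x - y‖ * ‖x - y‖ = 2 * (‖x‖ * ‖x‖ + ‖y‖ * ‖y‖) := by
  simp only [← pow_two, norm_sq_H1v]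
  rw [← Finset.sum_add_distrib, ← Finset.sum_add_distrib, Finset.mul_sum]
  refine Finset.sum_congr rfl fun j _ => ?_
  have h : ∀ f g : L2 Ω, ‖f + g‖ ^ 2 + ‖f - g‖ ^ 2 = 2 * (‖f‖ ^ 2 + ‖g‖ ^ 2) := fun f g => by
    simpa only [pow_two] using parallelogram_law_with_norm_mul ℝ f g
  have h1 := h ((x j : Jet Ω) none) ((y j : Jet Ω) none)
  have h2 := Finset.sum_congr (rfl : (Finset.univ : Finset (Fin d)) = _) fun i _ =>
    h ((x j : Jet Ω) (some i)) ((y j : Jet Ω) (some i))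
  rw [Finset.sum_add_distrib, ← Finset.mul_sum, Finset.sum_add_distrib] at h2
  simp only [PiLp.add_apply, PiLp.sub_apply, Submodule.coe_add, Submodule.coe_sub]
  linarith

set_option maxHeartbeats 1000000 in
/-- The linearized equations, written with bounded bilinear forms on `X` and `H¹₀(Ω)²`. -/
theorem exists_linearized_forms (hd : 2 ≤ d) (hΩ : IsOpen Ω)
    {K : Pt d → Matrix (Fin d) (Fin d) ℝ}
    (hKm : ∀ i j, AEMeasurable (fun x => K x i j) (volume.restrict Ω))
    (hKpos : ∃ κ > 0, ∀ x ∈ Ω, ∀ v : Fin d → ℝ, κ * (v ⬝ᵥ v) ≤ v ⬝ᵥ (K x).mulVec v)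
    {ν : ℝ → ℝ} {ν₁ ν₂ : ℝ} (hν₁ : 0 < ν₁) (hνb : ∀ t, ν₁ ≤ ν t ∧ ν t ≤ ν₂)
    (hν : ContDiff ℝ 2 ν) {CνT : ℝ≥0} (hν' : ∀ t, |deriv ν t| ≤ CνT)
    {F : Pt 2 → Pt d} (hF : ContDiff ℝ 2 F) {CFy : ℝ≥0} (hF' : ∀ z, ‖fderiv ℝ F z‖ ≤ CFy)
    {D : Matrix (Fin 2) (Fin 2) ℝ} {σ : ℝ} {p q : ℝ≥0∞} [ENNReal.HolderTriple p q 2]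
    {Mu My M C G α a₀ : ℝ≥0} (hC : embConst Ω 6 * embConst Ω 3 = C)
    (hG : CνT * embConst Ω p * gradEmbConst Ω σ q * M = G)
    (hα : coercAy Ω D = α) (hα0 : 0 < α) (ha₀ : a₀ < coercA Ω K ν) (ha₀pos : 0 < a₀)
    {ubar : H1v Ω d} {ybar : H1v Ω 2} (hdiv : divergence ubar = 0) (hu : MemFrac σ ubar)
    (huM : ‖ubar‖ ≤ Mu) (hyM : ‖ybar‖ ≤ My) (hfM : fracNorm σ ubar ≤ M) :
    ∃ (a : H1v Ω d →L[ℝ] H1v Ω d →L[ℝ] ℝ) (b : H1v Ω 2 →L[ℝ] H1v Ω d →L[ℝ] ℝ)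
      (e : H1v Ω 2 →L[ℝ] H1v Ω 2 →L[ℝ] ℝ) (g : H1v Ω d →L[ℝ] H1v Ω 2 →L[ℝ] ℝ),
      (∀ u ∈ X Ω, (a₀ - C * Mu : ℝ) * ‖u‖ ^ 2 ≤ a u u) ∧
      (∀ y u, |b y u| ≤ (G + CFy : ℝ) * ‖y‖ * ‖u‖) ∧
      (∀ y ∈ H10v Ω 2, (α : ℝ) * ‖y‖ ^ 2 ≤ e y y) ∧
      (∀ u y, |g u y| ≤ (C * My : ℝ) * ‖u‖ * ‖y‖) ∧
      (∀ ψ χ v, a ψ v + b χ v = formA K ν ybar ψ v + formC ψ ubar v + formC ubar ψ v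
        + formNuT ν ybar χ ubar v - formFy F ybar χ v) ∧
      ∀ ψ χ s, e χ s + g ψ s = formAy D χ s + formC ubar χ s + formC ψ ybar s := by
  have hd0 : 0 < d := by omega
  have hαR : (0 : ℝ) < α := hα0
  have ha₀R : (0 : ℝ) < a₀ := ha₀pos
  have hA := formA_bilin hΩ hKm hKpos hν₁ hνb hν.continuous ybar
  obtain ⟨TA, hTA⟩ := hA
  have hT₁ := formC_bilin_outer (m := d) le_rfl hC.le ubar
  obtain ⟨T₁, hT₁, hb₁⟩ := hT₁
  have hT₂ := formC_bilin_right (m := d) le_rfl hC.le ubar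
  obtain ⟨T₂, hT₂, -⟩ := hT₂
  have hT₃ := formNuT_bilin hd hν hν' hG.le ybar ubar hu
    hfM
  obtain ⟨T₃, hT₃, hb₃⟩ := hT₃
  have hT₄ := formFy_bilin (Ω := Ω) hF hF' ybar
  obtain ⟨T₄, hT₄, hb₄⟩ := hT₄
  have hTD := formAy_bilin (Ω := Ω) D
  obtain ⟨TD, hTD, -⟩ := hTD
  have hT₅ := formC_bilin_right hd hC.le ubar
  obtain ⟨T₅, hT₅, -⟩ := hT₅
  have hT₆ := formC_bilin_outer hd hC.le ybar
  obtain ⟨T₆, hT₆, hb₆⟩ := hT₆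
  have hfin : embConst Ω 6 * embConst Ω 3 ≠ ⊤ := by rw [hC]; exact ENNReal.coe_ne_top
  -- `T₂` and `T₅`, convection by `ū`, vanish on the diagonal. `T₁` is absorbed by the coercivity of
  -- `TA`; `T₃ - T₄` and `T₆` are the couplings.
  refine ⟨TA + T₁ + T₂, T₃ - T₄, TD + T₅, T₆, fun u hu => ?_, fun y u => ?_, fun y hy => ?_,
    fun u y => ?_, fun ψ χ v => ?_, fun ψ χ s => ?_⟩
  · have h1 : (a₀ : ℝ) * ‖u‖ ^ 2 ≤ TA u u := by
      rw [hTA]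
      refine le_formA_of_lt_coercA ha₀R (by simpa using ha₀) ybar ?_ ⟨u, hu.1⟩
      exact (hTA 0 0).symm.trans (map_zero _)
    have h2 : |T₁ u u| ≤ C * Mu * ‖u‖ ^ 2 := by
      refine (hb₁ u u).trans ?_
      rw [mul_assoc _ ‖u‖, ← pow_two]
      gcongr
    have h3 : T₂ u u = 0 := (hT₂ u u).trans (formC_self_eq_zero hΩ hd0 hfin hdiv hu.1)
    have h4 := neg_le_of_abs_le h2
    change _ ≤ TA u u + T₁ u u + T₂ u u
    linarith
  · have h1 := hb₃ y u
    have h2 := hb₄ y u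
    change |T₃ y u - T₄ y u| ≤ _
    refine (abs_sub _ _).trans ?_
    linarith
  · have h1 : (α : ℝ) * ‖y‖ ^ 2 ≤ TD y y := by
      rw [hTD]
      refine le_of_ofReal_mul_enorm_sq_le (v := (⟨y, hy⟩ : H10v Ω 2))
        (q := fun y : H10v Ω 2 => formAy D (y : H1v Ω 2) y) ?_ hαR ?_
      · exact (hTD 0 0).symm.trans (map_zero _)
      · have h5 := coercAy_mul_le D (⟨y, hy⟩ : H10v Ω 2)
        rw [hα] at h5
        rw [ENNReal.ofReal_coe_nnreal]
        exact h5
    have h2 : T₅ y y = 0 := (hT₅ y y).trans (formC_self_eq_zero hΩ hd0 hfin hdiv hy)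
    change _ ≤ TD y y + T₅ y y
    linarith
  · refine (hb₆ u y).trans ?_
    gcongr
  · change TA ψ v + T₁ ψ v + T₂ ψ v + (T₃ χ v - T₄ χ v) = _
    simp only [hTA, hT₁, hT₂, hT₃, hT₄, add_sub_assoc]
  · change TD χ s + T₅ χ s + T₆ ψ s = _
    simp only [hTD, hT₅, hT₆]

end DoublyDiffusive

/-! ### Well-posedness of the linearized problem -/

theorem mainTheorem7 {d : ℕ} (hd : d = 2 ∨ d = 3)
    -- the bounded Lipschitz domain
    (Ω : Set (Pt d)) (hΩne : Ω.Nonempty) (hΩo : IsOpen Ω) (hΩb : Bornology.IsBounded Ω)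
    (hΩL : HasLipschitzBoundary Ω)
    -- the permeability
    (K : Pt d → Matrix (Fin d) (Fin d) ℝ)
    (hKm : ∀ i j, AEMeasurable (fun x => K x i j) (volume.restrict Ω))
    (hKs : ∀ x ∈ Ω, (K x).IsSymm)
    (hKpos : ∃ κ > 0, ∀ x ∈ Ω, ∀ v : Fin d → ℝ, κ * (v ⬝ᵥ v) ≤ v ⬝ᵥ (K x).mulVec v)
    (hKinv : ∃ α₁ > 0, ∀ x ∈ Ω, ∀ v : Fin d → ℝ, α₁ * (v ⬝ᵥ v) ≤ v ⬝ᵥ ((K x)⁻¹).mulVec v)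
    -- the viscosity
    (ν : ℝ → ℝ) (ν₁ ν₂ : ℝ) (hν₁ : 0 < ν₁) (hνb : ∀ t, ν₁ ≤ ν t ∧ ν t ≤ ν₂)
    (hν : ContDiff ℝ 2 ν) (CνT : ℝ≥0) (hν' : ∀ t, |deriv ν t| ≤ CνT)
    (hν'' : ∃ C : ℝ, ∀ t, |iteratedDeriv 2 ν t| ≤ C)
    -- the buoyancy
    (F : Pt 2 → Pt d) (hF : ContDiff ℝ 2 F) (CFy : ℝ≥0) (hF' : ∀ z, ‖fderiv ℝ F z‖ ≤ CFy)
    (hF'' : ∃ C : ℝ, ∀ z, ‖iteratedFDeriv ℝ 2 F z‖ ≤ C)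
    -- the diffusion matrix
    (D : Matrix (Fin 2) (Fin 2) ℝ)
    (hD : ∃ α₂ > 0, ∀ s : Fin 2 → ℝ, α₂ * (s ⬝ᵥ s) ≤ s ⬝ᵥ D.mulVec s)
    (δ : ℝ) (hδ : δ ∈ Set.Ioo (0 : ℝ) (1 / 2))
    -- the bounds on the states and the smallness condition
    (Mu My M : ℝ≥0) (hMu : 0 < Mu) (hMy : 0 < My) (hM : 0 < M)
    (hsmall : Smallness Ω K ν D δ CνT CFy Mu My M) :
    ∃ Cψ > (0 : ℝ), ∃ Cχ > (0 : ℝ),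
      ∀ (ubar : X Ω) (ybar : H1v Ω 2),
        MemFrac (1 / 2 + δ) (ubar : H1v Ω d) → MemFrac (1 / 2 + δ) ybar →
        ‖ubar‖ ≤ Mu → ‖ybar‖ ≤ My →
        fracNorm (1 / 2 + δ) (ubar : H1v Ω d) + fracNorm (1 / 2 + δ) ybar ≤ M →
        ∀ (fhat : StrongDual ℝ (X Ω)) (ftil : StrongDual ℝ (H10v Ω 2)),
          (∃! p : X Ω × H10v Ω 2,
            IsLinearizedSolution K ν F D (ubar : H1v Ω d) ybar fhat ftil p.1 p.2) ∧
          ∀ (ψ : X Ω) (χ : H10v Ω 2),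
            IsLinearizedSolution K ν F D (ubar : H1v Ω d) ybar fhat ftil ψ χ →
              ‖ψ‖ ≤ Cψ * (‖fhat‖ + ‖ftil‖) ∧ ‖χ‖ ≤ Cχ * (‖fhat‖ + ‖ftil‖) := by
  have hd0 : 0 < d := by rcases hd with rfl | rfl <;> norm_num
  have hd2 : 2 ≤ d := by rcases hd with rfl | rfl <;> norm_num
  have := holderTriple_p₂_p₁ hd hδ
  have hconst :=
    hsmall.exists_real hΩo hΩne hΩb hd0 hD hMu hMy
  obtain ⟨C, G, α, a₀, hC, hG, hα, hα0, ha₀, hlt⟩ := hconst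
  have hlt' : (C : ℝ) * (G * My / α + Mu + CFy * My / α) < a₀ := by exact_mod_cast hlt
  have hαR : (0 : ℝ) < α := hα0
  have ha₀pos : (0 : ℝ) < a₀ := lt_of_le_of_lt (by positivity) hlt'
  -- The smallness condition after moving C M_u to the other side and multiplying by α: the
  -- inequality BE < Aα of the abstract result. It also forces A > 0, because its left side is
  -- nonnegative.
  have hprod : ((G : ℝ) + CFy) * (C * My) < (a₀ - C * Mu) * α := by
    have e : (C : ℝ) * (G * My / α + Mu + CFy * My / α)
        = C * Mu + (G + CFy) * (C * My) / α := by ring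
    rw [e, ← lt_sub_iff_add_lt', div_lt_iff₀ hαR] at hlt'
    exact hlt'
  have hA : (0 : ℝ) < a₀ - C * Mu :=
    pos_of_mul_pos_left (lt_of_le_of_lt (by positivity) hprod) hαR.le
  have hlm := @coupled_laxMilgram_submodule (H1v Ω d) (H1v Ω 2) normedAddCommGroup_H1v
    normedSpace_H1v normedAddCommGroup_H1v normedSpace_H1v (X Ω) (H10v Ω 2) completeSpace_X
    completeSpace_H10v parallelogram_H1v parallelogram_H1v (a₀ - C * Mu) (G + CFy) α (C * My)
    hA hαR (by positivity) (by positivity) hprod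
  obtain ⟨Q, hQ, key⟩ := hlm
  refine ⟨Q, hQ, Q, hQ, fun ubar ybar hu _ huM hyM huyM fhat ftil => ?_⟩
  have hforms := exists_linearized_forms hd2 hΩo hKm hKpos hν₁ hνb hν hν' hF hF' hC hG hα hα0 ha₀
    (by exact_mod_cast ha₀pos) ubar.2.2 hu huM hyM (le_self_add.trans huyM)
  obtain ⟨a, b, e, g, ha, hb, he, hg, hψ, hχ⟩ := hforms
  have hwp := key a b e g ha hb he hg fhat ftil
  simp only [hψ, hχ] at hwp
  exact ⟨hwp.1, fun ψ χ h => hwp.2 ψ χ h.1 h.2⟩
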